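/- All graphs are finite, simple and undirected. An orientation of a graph $G$ replaces every edge $\{u,v\}$ with exactly one of the arcs $(u,v)$, $(v,u)$. A cycle $C$ of $G$ is central if $G\setminus V(C)$ has a perfect matching. An orientation of $G$ is Pfaffian if, for every central cycle $C$ of $G$, both consistent (cyclic) orientations of $C$ have an odd number of arcs in common with it; a graph is Pfaffian if it has a Pfaffian orientation. Theorem. There is a deterministic linear-time algorithm that, given as input (i) a bipartite Pfaffian graph $G$ in which every vertex has degree at least three, (ii) a Hamiltonian cycle $H$ in $G$, and (iii) an edge $e\in E(H)$, outputs a Hamiltonian cycle $H'\neq H$ in $G$ with $e\in E(H')$. Here the input is a list of non-negative integers: the vertices are $0,\dots,n-1$, $G$ is given by adjacency lists (in any order), $H$ by its vertices in cyclic order (from any starting vertex, in either direction), and $e$ by its two ends; the output lists the vertices of $H'$ in cyclic order. Linear time means at most $c\,(n+m)$ elementary steps, where $n=|V(G)|$, $m=|E(G)|$ and $c$ is an absolute constant, on a unit-cost random access machine with addition, (truncated) subtraction, comparison and indirect addressing, whose words hold the integers in $[0,(n+m)^k)$ for an absolute constant $k$, that is, words of $O(\log(n+m))$ bits. -/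

import Mathlib

/-! ### Pfaffian graphs -/

namespace SimpleGraph

variable {V : Type*}

/-- `D` is an orientation of `G`: every edge `{u, v}` of `G` is replaced with exactly one of the
arcs `(u, v)` and `(v, u)`, and there are no other arcs. -/
structure IsOrientation (G : SimpleGraph V) (D : Digraph V) : Prop where
  adj_of_arc : ∀ u v, D.Adj u v → G.Adj u v
  arc_or_arc : ∀ u v, G.Adj u v → D.Adj u v ∨ D.Adj v u
  not_both : ∀ u v, ¬ (D.Adj u v ∧ D.Adj v u)

/-- The cycle traced by the closed walk `C` is central: `G` minus the vertices of `C` has a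
perfect matching. -/
def Walk.IsCentral {G : SimpleGraph V} {a : V} (C : G.Walk a a) : Prop :=
  ∃ M : (G.induce {v | v ∉ C.support}).Subgraph, M.IsPerfectMatching

open Classical in
/-- The number of arcs that the traversal `C` has in common with the directed graph `D`. -/
noncomputable def Walk.numCommonArcs {G : SimpleGraph V} {a : V} (C : G.Walk a a)
    (D : Digraph V) : ℕ :=
  C.darts.countP (fun d => decide (D.Adj d.fst d.snd))

/-- `D` is a Pfaffian orientation of `G`: both consistent orientations of every central cycle have
an odd number of arcs in common with `D`. A cycle is presented by a closed walk, which carries one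
of the two consistent orientations; the reversed closed walk carries the other one. -/
def IsPfaffianOrientation (G : SimpleGraph V) (D : Digraph V) : Prop :=
  G.IsOrientation D ∧
    ∀ (a : V) (C : G.Walk a a), C.IsCycle → C.IsCentral → Odd (C.numCommonArcs D)

/-- A graph is Pfaffian if it admits a Pfaffian orientation. -/
def IsPfaffian (G : SimpleGraph V) : Prop :=
  ∃ D : Digraph V, G.IsPfaffianOrientation D

end SimpleGraph

/-! ### A word RAM with unit-cost instructions

The machine has registers and a constant number (for each program) of random access memory arrays.
Its programs are structured; the only arithmetic operations are addition and truncated subtraction,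
and the only test is `<`. -/

namespace WordRAM

/-- The contents of the machine: register `i` holds `reg i`, and cell `j` of the memory array `a`
holds `mem a j`. -/
structure Store where
  reg : ℕ → ℕ
  mem : ℕ → ℕ → ℕ

/-- Expressions: constants, registers, indirectly addressed cells (`cell a e` is the cell of the
array `a` whose address is the value of `e`), sums and truncated differences. -/
inductive Expr where
  | const (k : ℕ)
  | reg (i : ℕ)
  | cell (a : ℕ) (e : Expr)
  | add (e f : Expr)
  | sub (e f : Expr)

namespace Expr

/-- The value of an expression. -/
def eval (s : Store) : Expr → ℕ
  | const k => k
  | reg i => s.reg i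
  | cell a e => s.mem a (e.eval s)
  | add e f => e.eval s + f.eval s
  | sub e f => e.eval s - f.eval s

/-- The number of elementary operations in the evaluation of an expression. -/
def cost : Expr → ℕ
  | const _ => 1
  | reg _ => 1
  | cell _ e => e.cost + 1
  | add e f => e.cost + f.cost + 1
  | sub e f => e.cost + f.cost + 1

/-- Every value (and address) that occurs in the evaluation of the expression is less than `B`. -/
def Fits (B : ℕ) (s : Store) : Expr → Prop
  | const k => k < B
  | reg i => s.reg i < B
  | cell a e => e.Fits B s ∧ s.mem a (e.eval s) < B
  | add e f => e.Fits B s ∧ f.Fits B s ∧ e.eval s + f.eval s < B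
  | sub e f => e.Fits B s ∧ f.Fits B s

end Expr

/-- Programs. -/
inductive Program where
  | skip
  /-- `reg i := e` -/
  | assign (i : ℕ) (e : Expr)
  /-- `mem a e := f` -/
  | store (a : ℕ) (e f : Expr)
  | seq (p q : Program)
  /-- `if e < f then p else q` -/
  | ifLt (e f : Expr) (p q : Program)
  /-- `while e < f do p` -/
  | whileLt (e f : Expr) (p : Program)

/-- `Run B p s t s'`: the program `p`, started in the store `s`, halts in the store `s'` after
exactly `t` elementary steps, and no value or address that occurs on the way is `B` or more (the
machine has words that hold the numbers less than `B`; it gets stuck on an overflow). -/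
inductive Run (B : ℕ) : Program → Store → ℕ → Store → Prop where
  | skip (s : Store) : Run B .skip s 1 s
  | assign (i : ℕ) (e : Expr) (s : Store) (he : e.Fits B s) :
      Run B (.assign i e) s (e.cost + 1)
        { s with reg := Function.update s.reg i (e.eval s) }
  | store (a : ℕ) (e f : Expr) (s : Store) (he : e.Fits B s) (hf : f.Fits B s) :
      Run B (.store a e f) s (e.cost + f.cost + 1)
        { s with
          mem := Function.update s.mem a (Function.update (s.mem a) (e.eval s) (f.eval s)) }
  | seq (p q : Program) (s₁ s₂ s₃ : Store) (t₁ t₂ : ℕ)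
      (hp : Run B p s₁ t₁ s₂) (hq : Run B q s₂ t₂ s₃) :
      Run B (.seq p q) s₁ (t₁ + t₂) s₃
  | ifLt_true (e f : Expr) (p q : Program) (s₁ s₂ : Store) (t : ℕ)
      (he : e.Fits B s₁) (hf : f.Fits B s₁) (h : e.eval s₁ < f.eval s₁) (hp : Run B p s₁ t s₂) :
      Run B (.ifLt e f p q) s₁ (e.cost + f.cost + 1 + t) s₂
  | ifLt_false (e f : Expr) (p q : Program) (s₁ s₂ : Store) (t : ℕ)
      (he : e.Fits B s₁) (hf : f.Fits B s₁) (h : ¬ e.eval s₁ < f.eval s₁) (hq : Run B q s₁ t s₂) :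
      Run B (.ifLt e f p q) s₁ (e.cost + f.cost + 1 + t) s₂
  | whileLt_true (e f : Expr) (p : Program) (s₁ s₂ s₃ : Store) (t₁ t₂ : ℕ)
      (he : e.Fits B s₁) (hf : f.Fits B s₁) (h : e.eval s₁ < f.eval s₁)
      (hp : Run B p s₁ t₁ s₂) (hw : Run B (.whileLt e f p) s₂ t₂ s₃) :
      Run B (.whileLt e f p) s₁ (e.cost + f.cost + 1 + t₁ + t₂) s₃
  | whileLt_false (e f : Expr) (p : Program) (s : Store)
      (he : e.Fits B s) (hf : f.Fits B s) (h : ¬ e.eval s < f.eval s) :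
      Run B (.whileLt e f p) s (e.cost + f.cost + 1) s

/-- The machine is deterministic: the final store and the number of steps are determined by the
program and the initial store. -/
theorem Run.deterministic {B : ℕ} {p : Program} {s : Store} {t : ℕ} {s' : Store}
    (h : Run B p s t s') : ∀ {t₂ : ℕ} {s₂ : Store}, Run B p s t₂ s₂ → t = t₂ ∧ s' = s₂ := by
  induction h with
  | skip | assign | store => intro _ _ h'; cases h'; exact ⟨rfl, rfl⟩
  | seq p q s₁ s₂ s₃ t₁ t₂ _ _ ihp ihq =>
    intro _ _ h'
    cases h' with
    | seq _ _ _ _ _ _ _ h₁ h₂ =>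
      obtain ⟨rfl, rfl⟩ := ihp h₁
      obtain ⟨rfl, rfl⟩ := ihq h₂
      exact ⟨rfl, rfl⟩
  | ifLt_true e f p q s₁ s₂ t _ _ h _ ih =>
    intro _ _ h'
    cases h' with
    | ifLt_true _ _ _ _ _ _ _ _ _ _ h₁ => obtain ⟨rfl, rfl⟩ := ih h₁; exact ⟨rfl, rfl⟩
    | ifLt_false _ _ _ _ _ _ _ _ _ h₀ _ => exact absurd h h₀
  | ifLt_false e f p q s₁ s₂ t _ _ h _ ih =>
    intro _ _ h'
    cases h' with
    | ifLt_true _ _ _ _ _ _ _ _ _ h₀ _ => exact absurd h₀ h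
    | ifLt_false _ _ _ _ _ _ _ _ _ _ h₁ => obtain ⟨rfl, rfl⟩ := ih h₁; exact ⟨rfl, rfl⟩
  | whileLt_true e f p s₁ s₂ s₃ t₁ t₂ _ _ h _ _ ih₁ ih₂ =>
    intro _ _ h'
    cases h' with
    | whileLt_true _ _ _ _ _ _ _ _ _ _ _ h₁ h₂ =>
      obtain ⟨rfl, rfl⟩ := ih₁ h₁
      obtain ⟨rfl, rfl⟩ := ih₂ h₂
      exact ⟨rfl, rfl⟩
    | whileLt_false _ _ _ _ _ _ h₀ => exact absurd h h₀
  | whileLt_false e f p s _ _ h =>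
    intro _ _ h'
    cases h' with
    | whileLt_true _ _ _ _ _ _ _ _ _ _ h₀ _ _ => exact absurd h₀ h
    | whileLt_false => exact ⟨rfl, rfl⟩

/-- The initial store on the input `x`: the array `0` holds the numbers of `x`, the register `0`
holds the length of `x`, and everything else is `0`. -/
def initStore (x : List ℕ) : Store where
  reg i := if i = 0 then x.length else 0
  mem a j := if a = 0 then x.getD j 0 else 0

/-- The output in a final store: the first `reg 0` cells of the array `1`. -/
def Store.output (s : Store) : List ℕ :=
  (List.range (s.reg 0)).map (s.mem 1)

/-- On the input `x`, the program `p` halts with the output `y` after at most `T` steps, on the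
machine whose words hold the numbers less than `B`. -/
def Program.Outputs (p : Program) (B T : ℕ) (x y : List ℕ) : Prop :=
  ∃ (t : ℕ) (s : Store), t ≤ T ∧ Run B p (initStore x) t s ∧ s.output = y

end WordRAM

/-! ### Encodings -/

namespace SimpleGraph

/-- `adj v` lists the neighbours of the vertex `v`, in some order and without repetition. -/
def IsAdjacencyLists {n : ℕ} (G : SimpleGraph (Fin n)) (adj : Fin n → List (Fin n)) : Prop :=
  ∀ v, (adj v).Nodup ∧ ∀ w, w ∈ adj v ↔ G.Adj v w

/-- The vertices of a cycle in cyclic order, each of them once. -/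
def Walk.cyclicOrder {n : ℕ} {G : SimpleGraph (Fin n)} {a : Fin n} (C : G.Walk a a) : List ℕ :=
  C.support.tail.map (fun v => (v : ℕ))

/-- The encoding of a graph on the vertices `0, …, n - 1`, a cycle and an edge `{u, v}`: first
`n, u, v`, then the vertices of the cycle in cyclic order, then for each vertex its degree
followed by its neighbours. -/
def encodeInput {n : ℕ} {G : SimpleGraph (Fin n)} (adj : Fin n → List (Fin n)) {a : Fin n}
    (H : G.Walk a a) (u v : Fin n) : List ℕ :=
  [n, (u : ℕ), (v : ℕ)] ++ H.cyclicOrder ++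
    (List.finRange n).flatMap (fun w => (adj w).length :: (adj w).map (fun z => (z : ℕ)))

end SimpleGraph

/-! Number the vertices along `H` so that the given edge joins the last position `n - 1` to the
position `0`. As `G` is bipartite, adjacent vertices have positions of different parity. An edge
between positions `i < j` closes up with the interval of `H` from `i` to `j` to a cycle, and this
cycle is central: alternate edges of `H` match the remaining vertices. Hence, after switching at
vertices, a Pfaffian orientation directs every edge towards the larger position, and every central
cycle has an odd number of ascents (`exists_potential`, `sum_ascents_eq_one`).

Every odd position `j` has a chord, to an even position `ch j`, because degrees are at least three.
Exchange this chord for the edge of `H` at `ch j` on the side of `j`. The other end of that edge is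
the odd position `chordStep ch j`, which has lost an edge; its own chord is exchanged next.
Iteration of this map on a finite set ends in a cycle of exchanges, and exactly these exchanges turn
`H` into a two-factor (`isTwoFactor_toggles`). The edge from `n - 1` to `0` is never removed, and
every even position other than `0` keeps one neighbour before it and one after it.

Each cycle of the two-factor is central, since the other ones are even. A cycle that misses the
position `0` passes each even position with two ascents or two descents, so its number of ascents is
even, which is impossible. So the two-factor is one Hamiltonian cycle (`reachable_zero`,
`exists_isHamiltonianCycle`); it contains the given edge, and it contains a chord, so it is not `H`.

The program reads each adjacency list once to choose chords, takes `n` steps of the map to reach the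
cycle of exchanges, performs `n` exchanges along it (repetitions are harmless), and walks along the
resulting links. Loop invariants give correctness, time and absence of overflow. -/

set_option maxHeartbeats 400000

/-! ### Pfaffian orientations and the order of a Hamiltonian cycle. -/

namespace SimpleGraph

variable {V : Type*}

open Classical in
/-- The number of arcs of `D` along `C`, modulo two. -/
theorem Walk.cast_numCommonArcs {G : SimpleGraph V} {a : V} (C : G.Walk a a) (D : Digraph V) :
    (C.numCommonArcs D : ZMod 2)
      = (C.darts.map fun d => if D.Adj d.fst d.snd then (1 : ZMod 2) else 0).sum := by
  unfold Walk.numCommonArcs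
  induction C.darts with
  | nil => simp
  | cons d l ih =>
    rw [List.countP_cons, List.map_cons, List.sum_cons, ← ih]
    by_cases h : D.Adj d.fst d.snd <;> simp [h, add_comm]

/-- Two arc weights that differ by a potential have the same sum, up to the potential of the
ends. -/
theorem Walk.sum_darts_of_potential {G : SimpleGraph V} (o s : V → V → ZMod 2) (g : V → ZMod 2)
    (h : ∀ x y, G.Adj x y → o x y = g x + g y + s x y) {a b : V} (W : G.Walk a b) :
    (W.darts.map fun d => o d.fst d.snd).sum
      = g a + g b + (W.darts.map fun d => s d.fst d.snd).sum := by
  induction W with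
  | nil => simp [CharTwo.add_self_eq_zero]
  | cons hd W ih =>
    rename_i x y z
    simp only [Walk.darts_cons, List.map_cons, List.sum_cons, ih, h _ _ hd]
    linear_combination CharTwo.add_self_eq_zero (g y)

/-- The complement of a cycle is perfectly matched by an involution along edges. -/
theorem Walk.isCentral_of_involution {G : SimpleGraph V} {a : V} (C : G.Walk a a) (τ : V → V)
    (h : ∀ x, x ∉ C.support → τ x ∉ C.support ∧ τ (τ x) = x ∧ G.Adj x (τ x)) : C.IsCentral := by
  refine ⟨{ verts := Set.univ, Adj := fun x y => τ x = y, adj_sub := ?_, edge_vert := ?_,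
            symm := ⟨?_⟩ }, ?_, ?_⟩
  · rintro ⟨x, hx⟩ ⟨y, hy⟩ hxy
    have := (h x hx).2.2
    simp only at hxy
    simpa [← hxy] using this
  · simp
  · rintro ⟨x, hx⟩ ⟨y, hy⟩ hxy
    simp only at hxy ⊢
    rw [← hxy, (h x hx).2.1]
  · rintro ⟨x, hx⟩ -
    exact ⟨⟨τ x, (h x hx).1⟩, rfl, fun y hy => Subtype.ext (Eq.symm (show τ x = y from hy))⟩
  · intro x; trivial

/-- The vertices of a bipartite graph in the order `p 0, …, p (n - 1)` of a Hamiltonian cycle;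
`q` is the inverse of `p`. -/
structure IsHamOrder (G : SimpleGraph V) (n : ℕ) (p : ℕ → V) (q : V → ℕ) : Prop where
  four_le : 4 ≤ n
  q_p : ∀ t < n, q (p t) = t
  q_lt : ∀ x, q x < n
  p_q : ∀ x, p (q x) = x
  adj_succ : ∀ t, t + 1 < n → G.Adj (p t) (p (t + 1))
  adj_last : G.Adj (p (n - 1)) (p 0)
  parity : ∀ x y, G.Adj x y → q x % 2 ≠ q y % 2

namespace IsHamOrder

variable {G : SimpleGraph V} {n : ℕ} {p : ℕ → V} {q : V → ℕ}

theorem even (h : G.IsHamOrder n p q) : n % 2 = 0 := by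
  have h1 := h.parity _ _ h.adj_last
  have h4 := h.four_le
  rw [h.q_p _ (by omega), h.q_p _ (by omega)] at h1
  omega

/-- The potential telescopes along an interval, so the sum of the arc weights depends only on the
ends and the length. The description of the edges serves to show that a chord closes the interval to
a cycle. -/
theorem exists_interval_walk (h : G.IsHamOrder n p q) (o : V → V → ZMod 2) (g : V → ZMod 2)
    (ho : ∀ t, t + 1 < n → o (p t) (p (t + 1)) = g (p t) + g (p (t + 1)) + 1) (m : ℕ) :
    ∀ i, i + m < n → ∃ W : G.Walk (p i) (p (i + m)),
      W.support = (List.range' i (m + 1)).map p ∧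
      (W.darts.map fun d => o d.fst d.snd).sum = g (p i) + g (p (i + m)) + m ∧
      ∀ e ∈ W.edges, ∃ t, i ≤ t ∧ t < i + m ∧ e = s(p t, p (t + 1)) := by
  induction m with
  | zero => intro i _; exact ⟨.nil, by simp, by simp [CharTwo.add_self_eq_zero], by simp⟩
  | succ m ih =>
    intro i hi
    obtain ⟨W, hW1, hW2, hW3⟩ := ih (i + 1) (by omega)
    refine ⟨(Walk.cons (h.adj_succ i (by omega)) W).copy rfl (by congr 1; omega), ?_, ?_, ?_⟩
    · rw [Walk.support_copy, Walk.support_cons, hW1, List.range'_succ (n := m + 1)]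
      rfl
    · simp only [Walk.darts_copy, Walk.darts_cons, List.map_cons, List.sum_cons, hW2,
        ho i (by omega), show i + 1 + m = i + (m + 1) by omega]
      push_cast
      linear_combination CharTwo.add_self_eq_zero (g (p (i + 1)))
    · intro e he
      rw [Walk.edges_copy, Walk.edges_cons, List.mem_cons] at he
      rcases he with rfl | he
      · exact ⟨i, le_rfl, by omega, rfl⟩
      · obtain ⟨t, h1, h2, h3⟩ := hW3 e he
        exact ⟨t, by omega, by omega, h3⟩

theorem nodup_map_range' (h : G.IsHamOrder n p q) (i m : ℕ) (hm : i + m ≤ n) :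
    ((List.range' i m).map p).Nodup := by
  refine List.Nodup.map_on ?_ (List.nodup_range')
  intro x hx y hy hxy
  rw [List.mem_range'_1] at hx hy
  rw [← h.q_p x (by omega), ← h.q_p y (by omega), hxy]

/-- An interval of the Hamiltonian cycle with an even number of vertices is left with a perfect
matching of its complement. -/
theorem isCentral_of_support (h : G.IsHamOrder n p q) {a : V} (C : G.Walk a a) (i j : ℕ)
    (hj : j < n) (hij : i < j) (hpar : i % 2 ≠ j % 2)
    (hC : ∀ x, x ∈ C.support ↔ i ≤ q x ∧ q x ≤ j) : C.IsCentral := by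
  have hn := h.even
  have h4 := h.four_le
  -- For even `i` every even position outside the interval is matched with its successor. For odd
  -- `i` the other alternate edges of the Hamiltonian cycle are used, including the one that joins
  -- `n - 1` to `0`.
  rcases Nat.mod_two_eq_zero_or_one i with hi | hi
  · refine C.isCentral_of_involution
      (fun x => if q x % 2 = 0 then p (q x + 1) else p (q x - 1)) fun x hx => ?_
    have hx' := h.q_lt x
    rw [hC] at hx
    rcases Nat.mod_two_eq_zero_or_one (q x) with hpx | hpx
    · have hq : q (p (q x + 1)) = q x + 1 := h.q_p _ (by omega)
      simp only [hpx, if_true, hC, hq]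
      refine ⟨by omega, ?_, ?_⟩
      · rw [if_neg (by omega), Nat.add_sub_cancel, h.p_q]
      · conv => enter [2]; rw [← h.p_q x]
        exact h.adj_succ _ (by omega)
    · have hq : q (p (q x - 1)) = q x - 1 := h.q_p _ (by omega)
      simp only [hpx, hC]
      refine ⟨by simp only [one_ne_zero, if_false, hq]; omega, ?_, ?_⟩
      · simp only [one_ne_zero, if_false, hq]
        rw [if_pos (by omega), Nat.sub_add_cancel (by omega), h.p_q]
      · simp only [one_ne_zero, if_false]
        have := h.adj_succ (q x - 1) (by omega)
        rw [Nat.sub_add_cancel (by omega), h.p_q] at this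
        exact this.symm
  · let τ : ℕ → ℕ := fun t =>
      if t = 0 then n - 1 else if t = n - 1 then 0 else if t % 2 = 0 then t - 1 else t + 1
    have τlt : ∀ t < n, τ t < n := by intro t ht; simp only [τ]; split_ifs <;> omega
    have ττ : ∀ t < n, τ (τ t) = t := by intro t ht; simp only [τ]; grind
    have τadj : ∀ t < n, G.Adj (p t) (p (τ t)) := by
      intro t ht
      simp only [τ]
      split_ifs with h1 h2 h3
      · rw [h1]; exact h.adj_last.symm
      · rw [h2]; exact h.adj_last
      · have := h.adj_succ (t - 1) (by omega)
        rw [Nat.sub_add_cancel (by omega)] at this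
        exact this.symm
      · exact h.adj_succ t (by omega)
    refine C.isCentral_of_involution (fun x => p (τ (q x))) fun x hx => ?_
    have hx' := h.q_lt x
    rw [hC] at hx
    refine ⟨?_, ?_, ?_⟩
    · rw [hC, h.q_p _ (τlt _ hx')]
      simp only [τ]; split_ifs <;> omega
    · rw [h.q_p _ (τlt _ hx'), ττ _ hx', h.p_q]
    · have := τadj (q x) hx'
      rwa [h.p_q] at this

open Classical in
/-- Up to switching at vertices, a Pfaffian orientation orients every edge from the end that comes
first in the order of a Hamiltonian cycle. -/
theorem exists_potential (h : G.IsHamOrder n p q) {D : Digraph V}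
    (hD : G.IsPfaffianOrientation D) :
    ∃ g : V → ZMod 2, ∀ x y, G.Adj x y → (if D.Adj x y then (1 : ZMod 2) else 0)
      = g x + g y + (if q x < q y then 1 else 0) := by
  let o : V → V → ZMod 2 := fun x y => if D.Adj x y then 1 else 0
  have hoo : ∀ x y, G.Adj x y → o x y = o y x + 1 := by
    intro x y hxy
    have h1 := hD.1.arc_or_arc _ _ hxy
    have h2 := hD.1.not_both x y
    simp only [o]
    by_cases hx : D.Adj x y <;> by_cases hy : D.Adj y x <;>
      simp_all [CharTwo.add_self_eq_zero]
  -- `g` changes its value across each arc of the Hamiltonian path that points backwards, so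
  -- switching by `g` makes all of them point forwards.
  let g : V → ZMod 2 := fun x => ∑ t ∈ Finset.range (q x), (o (p t) (p (t + 1)) + 1)
  have hg : ∀ t, t + 1 < n → o (p t) (p (t + 1)) = g (p t) + g (p (t + 1)) + 1 := by
    intro t ht
    simp only [g, h.q_p t (by omega), h.q_p (t + 1) ht, Finset.sum_range_succ]
    linear_combination -CharTwo.add_self_eq_zero
      (∑ t ∈ Finset.range t, (o (p t) (p (t + 1)) + 1)) - CharTwo.add_self_eq_zero (1 : ZMod 2)
  have key : ∀ i j, i < j → j < n → G.Adj (p i) (p j) → o (p i) (p j) = g (p i) + g (p j) + 1 := by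
    intro i j hij hj hadj
    have hpar := h.parity _ _ hadj
    rw [h.q_p i (by omega), h.q_p j hj] at hpar
    by_cases hj1 : j = i + 1
    · rw [hj1]; exact hg i (by omega)
    -- The test cycle takes the edge from `j` back to `i` and returns along the interval, whose
    -- length `m` is odd. The weight of the edge is the only unknown in its arc count.
    obtain ⟨m, rfl⟩ : ∃ m, j = i + m := ⟨j - i, by omega⟩
    obtain ⟨W, hW1, hW2, hW3⟩ := h.exists_interval_walk o g hg m i hj
    have hcyc : (Walk.cons hadj.symm W).IsCycle := by
      rw [Walk.cons_isCycle_iff]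
      refine ⟨Walk.IsPath.mk' ?_, fun he => ?_⟩
      · rw [hW1]; exact h.nodup_map_range' _ _ (by omega)
      · obtain ⟨t, h1, h2, h3⟩ := hW3 _ he
        rw [Sym2.eq_iff] at h3
        rcases h3 with ⟨h3, h4⟩ | ⟨h3, h4⟩
        · have := congrArg q h3
          rw [h.q_p _ hj, h.q_p t (by omega)] at this
          omega
        · have e1 := congrArg q h3
          have e2 := congrArg q h4
          rw [h.q_p _ hj, h.q_p _ (by omega)] at e1
          rw [h.q_p _ (by omega), h.q_p _ (by omega)] at e2
          omega
    have hcen : (Walk.cons hadj.symm W).IsCentral := by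
      refine h.isCentral_of_support _ i (i + m) hj hij hpar fun x => ?_
      rw [Walk.support_cons, hW1]
      simp only [List.mem_cons, List.mem_map, List.mem_range'_1]
      constructor
      · rintro (rfl | ⟨t, ht, rfl⟩)
        · rw [h.q_p _ hj]; omega
        · rw [h.q_p _ (by omega)]; omega
      · rintro ⟨h1, h2⟩
        exact Or.inr ⟨q x, by omega, h.p_q x⟩
    have hodd := hD.2 _ _ hcyc hcen
    have hz : ((Walk.cons hadj.symm W).numCommonArcs D : ZMod 2) = 1 :=
      ZMod.natCast_eq_one_iff_odd.2 hodd
    rw [Walk.cast_numCommonArcs, Walk.darts_cons, List.map_cons, List.sum_cons] at hz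
    change o (p (i + m)) (p i) + (W.darts.map fun d => o d.fst d.snd).sum = 1 at hz
    have hm : (m : ZMod 2) = 1 := ZMod.natCast_eq_one_iff_odd.2 (Nat.odd_iff.2 (by omega))
    rw [hW2, hoo _ _ hadj.symm, hm] at hz
    linear_combination hz - CharTwo.add_self_eq_zero (g (p i)) -
      CharTwo.add_self_eq_zero (g (p (i + m))) - CharTwo.add_self_eq_zero (1 : ZMod 2)
  refine ⟨g, fun x y hxy => ?_⟩
  change o x y = _
  have hne : q x ≠ q y := fun he => h.parity _ _ hxy (by rw [he])
  rcases lt_or_gt_of_ne hne with hlt | hlt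
  · have := key (q x) (q y) hlt (h.q_lt y) (by rwa [h.p_q, h.p_q])
    rw [h.p_q, h.p_q] at this
    rw [if_pos hlt, this]
  · have := key (q y) (q x) hlt (h.q_lt x) (by rw [h.p_q, h.p_q]; exact hxy.symm)
    rw [h.p_q, h.p_q] at this
    rw [if_neg (by omega), hoo _ _ hxy, this]
    linear_combination CharTwo.add_self_eq_zero (1 : ZMod 2)

/-- In a Pfaffian graph, every central cycle ascends an odd number of times in the order of a
Hamiltonian cycle. -/
theorem sum_ascents_eq_one (h : G.IsHamOrder n p q) (hG : G.IsPfaffian) {a : V} (C : G.Walk a a)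
    (hC : C.IsCycle) (hcen : C.IsCentral) :
    (C.darts.map fun d => if q d.fst < q d.snd then (1 : ZMod 2) else 0).sum = 1 := by
  classical
  obtain ⟨D, hD⟩ := hG
  obtain ⟨g, hg⟩ := h.exists_potential hD
  have h1 := C.sum_darts_of_potential (fun x y => if D.Adj x y then (1 : ZMod 2) else 0)
    (fun x y => if q x < q y then (1 : ZMod 2) else 0) g hg
  have h2 : (C.numCommonArcs D : ZMod 2) = 1 := ZMod.natCast_eq_one_iff_odd.2 (hD.2 _ _ hC hcen)
  rw [Walk.cast_numCommonArcs, h1] at h2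
  linear_combination h2 - CharTwo.add_self_eq_zero (g a)

end IsHamOrder

end SimpleGraph

/-! ### Two-factors of a Pfaffian graph that are Hamiltonian. -/

namespace SimpleGraph

variable {V : Type*}

theorem Walk.sum_darts_eq_sum_range {G : SimpleGraph V} {M : Type*} [AddCommMonoid M]
    (f : V → V → M) {a b : V} (W : G.Walk a b) :
    (W.darts.map fun d => f d.fst d.snd).sum
      = ∑ t ∈ Finset.range W.length, f (W.getVert t) (W.getVert (t + 1)) := by
  induction W with
  | nil => simp
  | cons h W ih =>
    rw [Walk.darts_cons, List.map_cons, List.sum_cons, ih, Walk.length_cons,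
      Finset.sum_range_succ', add_comm]
    simp

/-- Groups the darts of an even cycle in pairs. When the base point is at an odd position, the
middle vertex of each pair is at an even position. -/
theorem sum_range_two_mul {M : Type*} [AddCommMonoid M] (F : ℕ → M) (m : ℕ) :
    ∑ t ∈ Finset.range (2 * m), F t = ∑ k ∈ Finset.range m, (F (2 * k) + F (2 * k + 1)) := by
  induction m with
  | zero => simp
  | succ m ih =>
    rw [show 2 * (m + 1) = 2 * m + 1 + 1 by ring, Finset.sum_range_succ, Finset.sum_range_succ, ih,
      Finset.sum_range_succ, add_assoc]

/-- Regular graphs satisfy Hall's condition. -/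
theorem ncard_le_ncard_iUnion_neighborSet [Finite V] {G : SimpleGraph V} {d : ℕ} (hd : 0 < d)
    (h : ∀ x, (G.neighborSet x).ncard = d) (s : Set V) :
    s.ncard ≤ (⋃ x ∈ s, G.neighborSet x).ncard := by
  classical
  have := Fintype.ofFinite V
  -- Double counting of the edges between `s` and its neighbourhood: at least `d` at each vertex of
  -- the former, at most `d` at each vertex of the latter.
  have key := Finset.card_mul_le_card_mul (s := s.toFinset)
    (t := (⋃ x ∈ s, G.neighborSet x).toFinset) G.Adj (m := d) (n := d) ?_ ?_
  · rw [Set.ncard_eq_toFinset_card', Set.ncard_eq_toFinset_card']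
    exact Nat.le_of_mul_le_mul_right key hd
  · intro a ha
    rw [← h a, Set.ncard_eq_toFinset_card']
    refine Finset.card_le_card fun y hy => ?_
    rw [Set.mem_toFinset] at ha hy
    rw [Finset.mem_bipartiteAbove]
    refine ⟨?_, hy⟩
    rw [Set.mem_toFinset]
    exact Set.mem_biUnion ha hy
  · intro b _
    rw [← h b, Set.ncard_eq_toFinset_card']
    refine Finset.card_le_card fun y hy => ?_
    rw [Finset.mem_bipartiteBelow] at hy
    rw [Set.mem_toFinset]
    exact hy.2.symm

/-- Every vertex has the two neighbours at the positions given by `L` and `R`; on the even side,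
one of them comes first and the other one comes last, except at the position zero. -/
structure IsTwoFactor (G : SimpleGraph V) (n : ℕ) (p : ℕ → V) (L R : ℕ → ℕ) : Prop where
  L_lt : ∀ x < n, L x < n
  R_lt : ∀ x < n, R x < n
  ne : ∀ x < n, L x ≠ R x
  adj_L : ∀ x < n, G.Adj (p x) (p (L x))
  adj_R : ∀ x < n, G.Adj (p x) (p (R x))
  symm : ∀ x < n, ∀ y < n, y = L x ∨ y = R x → x = L y ∨ x = R y
  between : ∀ x < n, x % 2 = 0 → 0 < x → L x < x ∧ x < R x
  L_zero : L 0 = n - 1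

namespace IsTwoFactor

variable {G : SimpleGraph V} {n : ℕ} {p : ℕ → V} {q : V → ℕ} {L R : ℕ → ℕ}

/-- The two-factor as a graph. -/
def graph (hS : G.IsTwoFactor n p L R) (h : G.IsHamOrder n p q) : SimpleGraph V where
  Adj x y := q y = L (q x) ∨ q y = R (q x)
  symm := ⟨fun x y hxy => hS.symm _ (h.q_lt x) _ (h.q_lt y) hxy⟩
  loopless := ⟨fun x hx => by
    rcases hx with hx | hx
    · have := hS.adj_L _ (h.q_lt x)
      rw [← hx] at this
      exact this.ne rfl
    · have := hS.adj_R _ (h.q_lt x)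
      rw [← hx] at this
      exact this.ne rfl⟩

theorem graph_adj (hS : G.IsTwoFactor n p L R) (h : G.IsHamOrder n p q) (x y : V) :
    (hS.graph h).Adj x y ↔ q y = L (q x) ∨ q y = R (q x) := Iff.rfl

theorem graph_le (hS : G.IsTwoFactor n p L R) (h : G.IsHamOrder n p q) : hS.graph h ≤ G := by
  intro x y hxy
  rcases hxy with hxy | hxy
  · have := hS.adj_L _ (h.q_lt x)
    rwa [← hxy, h.p_q, h.p_q] at this
  · have := hS.adj_R _ (h.q_lt x)
    rwa [← hxy, h.p_q, h.p_q] at this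

theorem neighborSet_eq (hS : G.IsTwoFactor n p L R) (h : G.IsHamOrder n p q) (x : V) :
    (hS.graph h).neighborSet x = {p (L (q x)), p (R (q x))} := by
  ext y
  rw [mem_neighborSet, graph_adj, Set.mem_insert_iff, Set.mem_singleton_iff]
  have hx := h.q_lt x
  constructor
  · rintro (hy | hy)
    · left; rw [← hy, h.p_q]
    · right; rw [← hy, h.p_q]
  · rintro (rfl | rfl)
    · left; exact h.q_p _ (hS.L_lt _ hx)
    · right; exact h.q_p _ (hS.R_lt _ hx)

theorem ncard_neighborSet (hS : G.IsTwoFactor n p L R) (h : G.IsHamOrder n p q) (x : V) :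
    ((hS.graph h).neighborSet x).ncard = 2 := by
  rw [hS.neighborSet_eq h]
  refine Set.ncard_pair fun he => hS.ne _ (h.q_lt x) ?_
  rw [← h.q_p _ (hS.L_lt _ (h.q_lt x)), ← h.q_p _ (hS.R_lt _ (h.q_lt x)), he]

theorem isCycles (hS : G.IsTwoFactor n p L R) (h : G.IsHamOrder n p q) :
    (hS.graph h).IsCycles := fun x _ => hS.ncard_neighborSet h x

/-- The other cycles of the two-factor are even, so that they have a perfect matching. -/
theorem isCentral_mapLe [Finite V] (hS : G.IsTwoFactor n p L R) (h : G.IsHamOrder n p q) {b : V}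
    (C : (hS.graph h).Walk b b)
    (hC : ∀ x y, (hS.graph h).Adj x y → x ∈ C.support → y ∈ C.support) :
    (C.mapLe (hS.graph_le h)).IsCentral := by
  classical
  have := Fintype.ofFinite V
  have hsupp : (C.mapLe (hS.graph_le h)).support = C.support := by simp
  unfold Walk.IsCentral
  rw [hsupp]
  -- The support is closed under adjacency in the two-factor, so its removal leaves a two-regular
  -- graph, to which Hall's theorem applies.
  have hreg : ∀ x, (((hS.graph h).induce {v | v ∉ C.support}).neighborSet x).ncard = 2 := by
    rintro ⟨x, hx⟩
    rw [← hS.ncard_neighborSet h x, ← Set.ncard_image_of_injective _ Subtype.val_injective]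
    congr 1
    ext y
    simp only [Set.mem_image, mem_neighborSet, comap_adj, Subtype.exists]
    constructor
    · rintro ⟨z, hz, hxz, rfl⟩; exact hxz
    · intro hxy
      exact ⟨y, fun hy => hx (hC _ _ hxy.symm hy), hxy, rfl⟩
  have hbip : ((hS.graph h).induce {v | v ∉ C.support}).IsBipartiteWith
      {x | q x % 2 = 0} {x | q x % 2 = 1} := by
    refine ⟨Set.disjoint_left.2 fun x hx hy => ?_, fun x y hxy => ?_⟩
    · simp only [Set.mem_ofPred_eq] at hx hy; omega
    · have := h.parity _ _ (hS.graph_le h hxy)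
      simp only [Set.mem_ofPred_eq, Function.Embedding.subtype_apply] at this ⊢
      omega
  obtain ⟨M, hM⟩ := exists_isPerfectMatching_of_forall_ncard_le hbip
    (ncard_le_ncard_iUnion_neighborSet two_pos hreg)
  exact ⟨{ verts := M.verts, Adj := M.Adj, adj_sub := fun hxy => hS.graph_le h (M.adj_sub hxy),
           edge_vert := M.edge_vert, symm := M.symm }, hM⟩

/-- In a Pfaffian graph the two-factor is connected. -/
theorem reachable_zero [Finite V] (hS : G.IsTwoFactor n p L R) (h : G.IsHamOrder n p q)
    (hG : G.IsPfaffian) (v : V) : (hS.graph h).Reachable v (p 0) := by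
  -- With a base point at an odd position, the even positions on the cycle are exactly those at odd
  -- steps.
  obtain ⟨b, hb, hvb⟩ : ∃ b, q b % 2 = 1 ∧ (hS.graph h).Reachable v b := by
    rcases Nat.mod_two_eq_zero_or_one (q v) with hv | hv
    · have hadj : (hS.graph h).Adj v (p (L (q v))) := by
        left; exact h.q_p _ (hS.L_lt _ (h.q_lt v))
      have := h.parity _ _ (hS.graph_le h hadj)
      exact ⟨_, by omega, hadj.reachable⟩
    · exact ⟨v, hv, .refl v⟩
  refine hvb.trans ?_
  by_contra hcon
  obtain ⟨C, hCc, hCv⟩ := (hS.isCycles h).exists_cycle_toSubgraph_verts_eq_connectedComponentSupp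
    (v := b) (c := (hS.graph h).connectedComponentMk b) rfl
    (by rw [hS.neighborSet_eq h]; exact Set.insert_nonempty _ _)
  have hsupp : ∀ x, x ∈ C.support ↔ (hS.graph h).Reachable x b := by
    intro x
    rw [← Walk.mem_verts_toSubgraph, hCv, ConnectedComponent.mem_supp_iff, ConnectedComponent.eq]
  have hcen := hS.isCentral_mapLe h C fun x y hxy hx => by
    rw [hsupp] at hx ⊢
    exact hxy.symm.reachable.trans hx
  have hsum := h.sum_ascents_eq_one hG _ ((Walk.isCycle_mapLe (hS.graph_le h)).2 hCc) hcen
  rw [Walk.sum_darts_eq_sum_range (fun x y => if q x < q y then (1 : ZMod 2) else 0)] at hsum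
  have hlen : (C.mapLe (hS.graph_le h)).length = C.length := by simp
  have hget : ∀ t, (C.mapLe (hS.graph_le h)).getVert t = C.getVert t := by
    intro t; simp [Walk.mapLe]
  simp only [hlen, hget] at hsum
  have hpar : ∀ t ≤ C.length, q (C.getVert t) % 2 = (t + 1) % 2 := by
    intro t
    induction t with
    | zero => intro _; rw [Walk.getVert_zero, hb]
    | succ t ih =>
      intro ht
      have := h.parity _ _ (hS.graph_le h (C.adj_getVert_succ (i := t) (by omega)))
      have := ih (by omega)
      omega
  have heven := hpar C.length le_rfl
  rw [Walk.getVert_length, hb] at heven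
  obtain ⟨m, hm⟩ : ∃ m, C.length = 2 * m := ⟨C.length / 2, by omega⟩
  rw [hm, sum_range_two_mul, Finset.sum_eq_zero] at hsum
  · exact zero_ne_one hsum
  intro k hk
  rw [Finset.mem_range] at hk
  have e1 : (hS.graph h).Adj (C.getVert (2 * k + 1)) (C.getVert (2 * k)) :=
    (C.adj_getVert_succ (i := 2 * k) (by omega)).symm
  have e2 : (hS.graph h).Adj (C.getVert (2 * k + 1)) (C.getVert (2 * k + 1 + 1)) :=
    C.adj_getVert_succ (i := 2 * k + 1) (by omega)
  have hne : C.getVert (2 * k) ≠ C.getVert (2 * k + 1 + 1) :=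
    hCc.getVert_sub_one_ne_getVert_add_one (i := 2 * k + 1) (by omega)
  have hmem := C.getVert_mem_support (2 * k + 1)
  have hp := hpar (2 * k + 1) (by omega)
  generalize C.getVert (2 * k) = x at *
  generalize C.getVert (2 * k + 1) = a at *
  generalize C.getVert (2 * k + 1 + 1) = y at *
  have hne' : q x ≠ q y := fun he => hne (by rw [← h.p_q x, he, h.p_q])
  -- The position `0` is the only even one about which `between` says nothing; it lies in another
  -- component.
  have ha0 : q a ≠ 0 := by
    intro he
    refine hcon ?_
    rw [← he, h.p_q]
    exact ((hsupp a).1 hmem).symm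
  have hb' := hS.between (q a) (h.q_lt a) (by omega) (by omega)
  rw [graph_adj] at e1 e2
  -- The two darts at `a` both ascend or both descend, so together they contribute zero modulo two.
  by_cases hx : q x < q a
  · rw [if_pos hx, if_pos (by omega)]; exact CharTwo.add_self_eq_zero _
  · rw [if_neg hx, if_neg (by omega), add_zero]

/-- The walk along the two-factor: the position that comes `t` steps after the position `0`,
together with its predecessor. -/
def trav (L R : ℕ → ℕ) (n : ℕ) : ℕ → ℕ × ℕ
  | 0 => (n - 1, 0)
  | t + 1 => ((trav L R n t).2,
      if L (trav L R n t).2 = (trav L R n t).1 then R (trav L R n t).2 else L (trav L R n t).2)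

/-- In a Pfaffian graph the two-factor is a Hamiltonian cycle, and the walk along it finds its
vertices in cyclic order. -/
theorem exists_isHamiltonianCycle [Finite V] [DecidableEq V] (hS : G.IsTwoFactor n p L R)
    (h : G.IsHamOrder n p q) (hG : G.IsPfaffian) :
    ∃ C : G.Walk (p (n - 1)) (p (n - 1)), C.IsHamiltonianCycle ∧
      (∀ t < C.length, C.getVert (t + 1) = p (trav L R n t).2) ∧
      ∀ x < n, s(p x, p (L x)) ∈ C.edges ∧ s(p x, p (R x)) ∈ C.edges := by
  have := Fintype.ofFinite V
  have h4 := h.four_le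
  have hadj0 : (hS.graph h).Adj (p (n - 1)) (p 0) := by
    rw [adj_comm, graph_adj, h.q_p _ (by omega), h.q_p _ (by omega), hS.L_zero]
    exact Or.inl rfl
  obtain ⟨C, hCc, hCv⟩ := (hS.isCycles h).exists_cycle_toSubgraph_verts_eq_connectedComponentSupp
    (v := p (n - 1)) (c := (hS.graph h).connectedComponentMk (p (n - 1))) rfl ⟨_, hadj0⟩
  have hsupp : ∀ x, x ∈ C.support := by
    intro x
    rw [← Walk.mem_verts_toSubgraph, hCv, ConnectedComponent.mem_supp_iff, ConnectedComponent.eq]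
    exact (hS.reachable_zero h hG x).trans (hS.reachable_zero h hG _).symm
  -- The cycle and the two-factor are both two-regular on all vertices, so the cycle uses every edge
  -- of the two-factor.
  have hnb : ∀ x, C.toSubgraph.neighborSet x = (hS.graph h).neighborSet x := by
    intro x
    refine Set.eq_of_subset_of_ncard_le (C.toSubgraph.neighborSet_subset x) ?_ (Set.toFinite _)
    rw [hS.ncard_neighborSet h, hCc.ncard_neighborSet_toSubgraph_eq_two (hsupp x)]
  -- The direction of the cycle is chosen so that it begins with the step from `n - 1` to `0`, as
  -- `trav` does.
  obtain ⟨C, hCc, hsupp, hnb, hC1⟩ : ∃ C : (hS.graph h).Walk (p (n - 1)) (p (n - 1)), C.IsCycle ∧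
      (∀ x, x ∈ C.support) ∧ (∀ x, C.toSubgraph.neighborSet x = (hS.graph h).neighborSet x) ∧
      C.getVert 1 = p 0 := by
    have : p 0 ∈ C.toSubgraph.neighborSet (p (n - 1)) := by rw [hnb]; exact hadj0
    rw [hCc.neighborSet_toSubgraph_endpoint] at this
    rcases this with h0 | h0
    · exact ⟨C, hCc, hsupp, hnb, h0.symm⟩
    · exact ⟨C.reverse, hCc.reverse, by simpa using hsupp, by simpa using hnb, by
        rw [Walk.getVert_reverse]; exact h0.symm⟩
  have hlen3 := hCc.three_le_length
  refine ⟨C.mapLe (hS.graph_le h), ?_, ?_, ?_⟩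
  · rw [Walk.isHamiltonianCycle_isCycle_and_isHamiltonian_tail]
    have hc' := (Walk.isCycle_mapLe (hS.graph_le h)).2 hCc
    refine ⟨hc', (hc'.isPath_tail).isHamiltonian_of_mem fun w => ?_⟩
    rw [Walk.support_tail_of_not_nil _ hc'.not_nil]
    have hw : w ∈ (C.mapLe (hS.graph_le h)).support := by simpa using hsupp w
    rw [Walk.mem_support_iff] at hw
    rcases hw with rfl | hw
    · exact Walk.end_mem_tail_support hc'.not_nil
    · exact hw
  · have hlen : (C.mapLe (hS.graph_le h)).length = C.length := by simp
    have hget : ∀ t, (C.mapLe (hS.graph_le h)).getVert t = C.getVert t := by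
      intro t; simp [Walk.mapLe]
    simp only [hlen, hget]
    have key : ∀ t < C.length, (trav L R n t).2 = q (C.getVert (t + 1)) ∧
        (trav L R n t).1 = q (C.getVert t) := by
      intro t
      induction t with
      | zero =>
        intro _
        rw [hC1, Walk.getVert_zero, h.q_p _ (by omega), h.q_p _ (by omega)]
        exact ⟨rfl, rfl⟩
      | succ t ih =>
        intro ht
        obtain ⟨i1, i2⟩ := ih (by omega)
        simp only [trav, i1, i2]
        refine ⟨?_, trivial⟩
        have e1 := (C.adj_getVert_succ (i := t) (by omega)).symm
        have e2 := C.adj_getVert_succ (i := t + 1) (by omega)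
        have hne : C.getVert t ≠ C.getVert (t + 1 + 1) :=
          hCc.getVert_sub_one_ne_getVert_add_one (i := t + 1) (by omega)
        have hne' : q (C.getVert t) ≠ q (C.getVert (t + 1 + 1)) := fun he => hne (by
          rw [← h.p_q (C.getVert t), he, h.p_q])
        rw [graph_adj] at e1 e2
        split_ifs with hif <;> omega
    intro t ht
    rw [(key t ht).1, h.p_q]
  · intro x hx
    have he : (C.mapLe (hS.graph_le h)).edges = C.edges := by simp
    rw [he]
    have : ∀ y, (hS.graph h).Adj (p x) y → s(p x, y) ∈ C.edges := by
      intro y hy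
      have hy' : y ∈ C.toSubgraph.neighborSet (p x) := by rw [hnb]; exact hy
      rwa [Subgraph.mem_neighborSet, ← Subgraph.mem_edgeSet, Walk.mem_edges_toSubgraph] at hy'
    refine ⟨this _ ?_, this _ ?_⟩
    · rw [graph_adj, h.q_p _ hx, h.q_p _ (hS.L_lt _ hx)]; exact Or.inl rfl
    · rw [graph_adj, h.q_p _ hx, h.q_p _ (hS.R_lt _ hx)]; exact Or.inr rfl

end IsTwoFactor

end SimpleGraph

/-! ### Exchanging chords for edges of the Hamiltonian cycle. -/

namespace SimpleGraph

variable {V : Type*}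

/-- The edge between the positions `j` and `i` is a chord of the cyclic order of length `n`. -/
def IsChord (G : SimpleGraph V) (n : ℕ) (p : ℕ → V) (j i : ℕ) : Prop :=
  i < n ∧ G.Adj (p j) (p i) ∧ (i + 1 < j ∧ j + 1 < i + n ∨ j + 1 < i)

/-- If the chord from `j` to `ch j` is added, then `ch j` loses its neighbour on the same side as
`j`. -/
def chordStep (ch : ℕ → ℕ) (j : ℕ) : ℕ := if ch j < j then ch j + 1 else ch j - 1

/-- The links after the chord at `j` has been exchanged for an edge of the Hamiltonian cycle. -/
def toggle (ch : ℕ → ℕ) (j : ℕ) (S : (ℕ → ℕ) × (ℕ → ℕ)) : (ℕ → ℕ) × (ℕ → ℕ) :=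
  if ch j < j then
    (Function.update S.1 (ch j + 1) (ch (ch j + 1)), Function.update S.2 (ch j) j)
  else
    (Function.update S.1 (ch j) j, Function.update S.2 (ch j - 1) (ch (ch j - 1)))

/-- The links after `t` exchanges. -/
def toggles (ch : ℕ → ℕ) (n : ℕ) : ℕ → (ℕ → ℕ) × (ℕ → ℕ)
  | 0 => (fun x => if x = 0 then n - 1 else x - 1, fun x => if x + 1 = n then 0 else x + 1)
  | t + 1 => toggle ch ((chordStep ch)^[n + t] 1) (toggles ch n t)

/-- The exchange at `j` makes `v` the left link of `x`. -/
def SetsLeft (ch : ℕ → ℕ) (j x v : ℕ) : Prop :=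
  ch j < j ∧ x = ch j + 1 ∧ v = ch x ∨ j < ch j ∧ x = ch j ∧ v = j

/-- The exchange at `j` makes `v` the right link of `x`. -/
def SetsRight (ch : ℕ → ℕ) (j x v : ℕ) : Prop :=
  ch j < j ∧ x = ch j ∧ v = j ∨ j < ch j ∧ x + 1 = ch j ∧ v = ch x

/-- The values that an exchange writes depend on `ch` and its position, never on the current links.
So a link holds a value that some exchange writes, or it is initial and no exchange touches it. In
this form the order and the repetition of the exchanges no longer matter. -/
theorem toggles_spec (ch : ℕ → ℕ) (n T : ℕ)
    (hne : ∀ t < T, ch ((chordStep ch)^[n + t] 1) ≠ (chordStep ch)^[n + t] 1) (x : ℕ) :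
    ((∃ t < T, SetsLeft ch ((chordStep ch)^[n + t] 1) x ((toggles ch n T).1 x)) ∨
      (toggles ch n T).1 x = (toggles ch n 0).1 x ∧
        ∀ t < T, ∀ v, ¬ SetsLeft ch ((chordStep ch)^[n + t] 1) x v) ∧
    ((∃ t < T, SetsRight ch ((chordStep ch)^[n + t] 1) x ((toggles ch n T).2 x)) ∨
      (toggles ch n T).2 x = (toggles ch n 0).2 x ∧
        ∀ t < T, ∀ v, ¬ SetsRight ch ((chordStep ch)^[n + t] 1) x v) := by
  induction T with
  | zero => simp
  | succ T ih =>
    obtain ⟨i1, i2⟩ := ih fun t ht => hne t (by omega)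
    have hT := hne T (by omega)
    rw [show toggles ch n (T + 1)
      = toggle ch ((chordStep ch)^[n + T] 1) (toggles ch n T) from rfl]
    constructor
    · by_cases hs : ∃ v, SetsLeft ch ((chordStep ch)^[n + T] 1) x v
      · left
        refine ⟨T, by omega, ?_⟩
        obtain ⟨v, hv⟩ := hs
        rcases hv with ⟨h1, h2, h3⟩ | ⟨h1, h2, h3⟩
        · left
          refine ⟨h1, h2, ?_⟩
          simp [toggle, h1, h2]
        · right
          refine ⟨h1, h2, ?_⟩
          simp [toggle, h2, not_lt.2 h1.le]
      · have hx : (toggle ch ((chordStep ch)^[n + T] 1) (toggles ch n T)).1 x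
            = (toggles ch n T).1 x := by
          unfold toggle
          split_ifs with hlt
          · exact Function.update_of_ne (fun he => hs ⟨_, Or.inl ⟨hlt, he, rfl⟩⟩) _ _
          · exact Function.update_of_ne
              (fun he => hs ⟨_, Or.inr ⟨by omega, he, rfl⟩⟩) _ _
        rw [hx]
        rcases i1 with ⟨t, ht, h1⟩ | ⟨h1, h2⟩
        · exact Or.inl ⟨t, by omega, h1⟩
        · refine Or.inr ⟨h1, fun t ht v hv => ?_⟩
          rcases Nat.lt_succ_iff_lt_or_eq.1 ht with ht | rfl
          · exact h2 t ht v hv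
          · exact hs ⟨v, hv⟩
    · by_cases hs : ∃ v, SetsRight ch ((chordStep ch)^[n + T] 1) x v
      · left
        refine ⟨T, by omega, ?_⟩
        obtain ⟨v, hv⟩ := hs
        rcases hv with ⟨h1, h2, h3⟩ | ⟨h1, h2, h3⟩
        · left
          refine ⟨h1, h2, ?_⟩
          simp [toggle, h1, h2]
        · right
          refine ⟨h1, h2, ?_⟩
          have hx : ch ((chordStep ch)^[n + T] 1) - 1 = x := by omega
          simp [toggle, hx, not_lt.2 h1.le]
      · have hx : (toggle ch ((chordStep ch)^[n + T] 1) (toggles ch n T)).2 x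
            = (toggles ch n T).2 x := by
          unfold toggle
          split_ifs with hlt
          · exact Function.update_of_ne (fun he => hs ⟨_, Or.inl ⟨hlt, he, rfl⟩⟩) _ _
          · exact Function.update_of_ne
              (fun he => hs ⟨_, Or.inr ⟨by omega, by omega, rfl⟩⟩) _ _
        rw [hx]
        rcases i2 with ⟨t, ht, h1⟩ | ⟨h1, h2⟩
        · exact Or.inl ⟨t, by omega, h1⟩
        · refine Or.inr ⟨h1, fun t ht v hv => ?_⟩
          rcases Nat.lt_succ_iff_lt_or_eq.1 ht with ht | rfl
          · exact h2 t ht v hv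
          · exact hs ⟨v, hv⟩

/-- An orbit among `n` values is periodic after `n` steps, with a period of at most `n`. -/
theorem exists_period_of_iterate_lt (f : ℕ → ℕ) (n z : ℕ) (h : ∀ t, f^[t] z < n) :
    ∃ d, 0 < d ∧ d ≤ n ∧ ∀ m, n ≤ m → f^[m + d] z = f^[m] z := by
  obtain ⟨a, ha, b, hb, hab, he⟩ := Finset.exists_ne_map_eq_of_card_lt_of_maps_to
    (s := Finset.range (n + 1)) (t := Finset.range n) (f := fun t => f^[t] z) (by simp)
    (fun t _ => by simpa using h t)
  wlog hlt : a < b generalizing a b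
  · exact this b hb a ha hab.symm he.symm (by omega)
  simp only [Finset.mem_range] at ha hb he
  refine ⟨b - a, by omega, by omega, fun m hm => ?_⟩
  rw [show m + (b - a) = (m - a) + b by omega, Function.iterate_add_apply, ← he,
    ← Function.iterate_add_apply, Nat.sub_add_cancel (by omega)]

namespace IsHamOrder

variable {G : SimpleGraph V} {n : ℕ} {p : ℕ → V} {q : V → ℕ}

theorem isChord_parity (h : G.IsHamOrder n p q) {j i : ℕ} (hj : j < n) (hc : G.IsChord n p j i) :
    j % 2 ≠ i % 2 := by
  have := h.parity _ _ hc.2.1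
  rwa [h.q_p _ hj, h.q_p _ hc.1] at this

/-- The far end of the chord is at an even position, and the step goes from there one place back
towards `j`; it stays between the two ends and never wraps around. -/
theorem chordStep_odd (h : G.IsHamOrder n p q) {ch : ℕ → ℕ}
    (hch : ∀ j < n, j % 2 = 1 → G.IsChord n p j (ch j)) {j : ℕ} (hj : j < n) (hodd : j % 2 = 1) :
    chordStep ch j < n ∧ chordStep ch j % 2 = 1 := by
  have hc := hch j hj hodd
  have h1 := h.isChord_parity hj hc
  have h2 := hc.1
  have h3 := h.even
  have h4 := hc.2.2
  unfold chordStep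
  split_ifs <;> omega

theorem iterate_chordStep_odd (h : G.IsHamOrder n p q) {ch : ℕ → ℕ}
    (hch : ∀ j < n, j % 2 = 1 → G.IsChord n p j (ch j)) (t : ℕ) :
    (chordStep ch)^[t] 1 < n ∧ (chordStep ch)^[t] 1 % 2 = 1 := by
  induction t with
  | zero =>
    have := h.four_le
    exact ⟨show 1 < n by omega, rfl⟩
  | succ t ih => rw [Function.iterate_succ_apply']; exact h.chordStep_odd hch ih.1 ih.2

/-- The exchanges along a cycle of chords give a two-factor with at least one chord. -/
theorem isTwoFactor_toggles (h : G.IsHamOrder n p q) {ch : ℕ → ℕ}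
    (hch : ∀ j < n, j % 2 = 1 → G.IsChord n p j (ch j)) :
    G.IsTwoFactor n p (toggles ch n n).1 (toggles ch n n).2 ∧
      ∃ j < n, j % 2 = 1 ∧ ((toggles ch n n).1 j = ch j ∨ (toggles ch n n).2 j = ch j) := by
  have h4 := h.four_le
  have hev := h.even
  have hiter := h.iterate_chordStep_odd hch
  set f := chordStep ch with hf
  obtain ⟨d, hd0, hdn, hd⟩ := exists_period_of_iterate_lt f n 1 fun t => (hiter t).1
  -- After `n` steps the orbit is periodic with period at most `n`, so the next `n` values run
  -- through a whole cycle of `f`, on which `f` is a permutation.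
  set Z : Set ℕ := {j | ∃ t < n, f^[n + t] 1 = j} with hZ
  have hZodd : ∀ j ∈ Z, j < n ∧ j % 2 = 1 := by
    rintro j ⟨t, -, rfl⟩; exact hiter _
  have hZch : ∀ j ∈ Z, G.IsChord n p j (ch j) := fun j hj => hch j (hZodd j hj).1 (hZodd j hj).2
  have hZpar : ∀ j ∈ Z, ch j % 2 = 0 := fun j hj => by
    have := h.isChord_parity (hZodd j hj).1 (hZch j hj)
    have := (hZodd j hj).2
    omega
  have hZf : ∀ j ∈ Z, f j ∈ Z := by
    rintro j ⟨t, ht, rfl⟩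
    rw [← Function.iterate_succ_apply' f]
    by_cases ht' : t + 1 < n
    · exact ⟨t + 1, ht', rfl⟩
    · refine ⟨t + 1 - d, by omega, ?_⟩
      rw [← hd _ (by omega)]
      exact congrArg (fun m => f^[m] 1) (by omega)
  have hZsurj : ∀ j ∈ Z, ∃ i ∈ Z, f i = j := by
    rintro j ⟨t, ht, rfl⟩
    rcases Nat.eq_zero_or_pos t with rfl | ht0
    · refine ⟨_, ⟨d - 1, by omega, rfl⟩, ?_⟩
      rw [← Function.iterate_succ_apply' f, ← hd (n + 0) (by omega)]
      exact congrArg (fun m => f^[m] 1) (by omega)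
    · refine ⟨_, ⟨t - 1, by omega, rfl⟩, ?_⟩
      rw [← Function.iterate_succ_apply' f]
      exact congrArg (fun m => f^[m] 1) (by omega)
  -- A further `d - 1` steps undo one step, whence injectivity on `Z`.
  have hZper : ∀ j ∈ Z, f^[d - 1] (f j) = j := by
    rintro j ⟨t, ht, rfl⟩
    rw [← Function.iterate_succ_apply' f, ← Function.iterate_add_apply]
    conv => rhs; rw [← hd _ (by omega)]
    exact congrArg (fun m => f^[m] 1) (by omega)
  have hZinj : ∀ i ∈ Z, ∀ j ∈ Z, f i = f j → i = j := by
    intro i hi j hj hij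
    rw [← hZper i hi, hij, hZper j hj]
  have hfd : ∀ j ∈ Z, ch j < j ∧ f j = ch j + 1 ∨ j < ch j ∧ f j + 1 = ch j := by
    intro j hj
    have := (hZch j hj).2.2
    by_cases hlt : ch j < j
    · exact Or.inl ⟨hlt, by rw [hf, chordStep, if_pos hlt]⟩
    · exact Or.inr ⟨by omega, by rw [hf, chordStep, if_neg hlt]; omega⟩
  have hspec := toggles_spec ch n n fun t ht he => by
    have := (hZch _ ⟨t, ht, rfl⟩).2.2
    change ch (f^[n + t] 1) = f^[n + t] 1 at he
    omega
  set L := (toggles ch n n).1 with hL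
  set R := (toggles ch n n).2 with hR
  have hLs : ∀ x, (∃ j ∈ Z, SetsLeft ch j x (L x)) ∨
      L x = (if x = 0 then n - 1 else x - 1) ∧ ∀ j ∈ Z, ∀ v, ¬ SetsLeft ch j x v := by
    intro x
    rcases (hspec x).1 with ⟨t, ht, h1⟩ | ⟨h1, h2⟩
    · exact Or.inl ⟨_, ⟨t, ht, rfl⟩, h1⟩
    · refine Or.inr ⟨h1, ?_⟩
      rintro j ⟨t, ht, rfl⟩
      exact h2 t ht
  have hRs : ∀ x, (∃ j ∈ Z, SetsRight ch j x (R x)) ∨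
      R x = (if x + 1 = n then 0 else x + 1) ∧ ∀ j ∈ Z, ∀ v, ¬ SetsRight ch j x v := by
    intro x
    rcases (hspec x).2 with ⟨t, ht, h1⟩ | ⟨h1, h2⟩
    · exact Or.inl ⟨_, ⟨t, ht, rfl⟩, h1⟩
    · refine Or.inr ⟨h1, ?_⟩
      rintro j ⟨t, ht, rfl⟩
      exact h2 t ht
  -- Parity separates the two ways to write a link: an even position receives a chord that ends
  -- there, an odd position receives its own chord.
  have hLe : ∀ x < n, x % 2 = 0 → (∃ j ∈ Z, j < ch j ∧ x = ch j ∧ L x = j) ∨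
      L x = (if x = 0 then n - 1 else x - 1) ∧ ∀ j ∈ Z, j < ch j → x ≠ ch j := by
    intro x _ hx
    rcases hLs x with ⟨j, hj, ⟨h1, h2, h3⟩ | h1⟩ | ⟨h1, h2⟩
    · have := hZpar j hj; omega
    · exact Or.inl ⟨j, hj, h1⟩
    · exact Or.inr ⟨h1, fun j hj hlt he => h2 j hj j (Or.inr ⟨hlt, he, rfl⟩)⟩
  have hRe : ∀ x < n, x % 2 = 0 → (∃ j ∈ Z, ch j < j ∧ x = ch j ∧ R x = j) ∨
      R x = x + 1 ∧ ∀ j ∈ Z, ch j < j → x ≠ ch j := by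
    intro x _ hx
    rcases hRs x with ⟨j, hj, h1 | ⟨h1, h2, h3⟩⟩ | ⟨h1, h2⟩
    · exact Or.inl ⟨j, hj, h1⟩
    · have := hZpar j hj; omega
    · rw [if_neg (by omega)] at h1
      exact Or.inr ⟨h1, fun j hj hlt he => h2 j hj j (Or.inl ⟨hlt, he, rfl⟩)⟩
  have hLo : ∀ x < n, x % 2 = 1 → (∃ j ∈ Z, ch j < j ∧ x = ch j + 1 ∧ L x = ch x) ∨
      L x = x - 1 ∧ ∀ j ∈ Z, ch j < j → x ≠ ch j + 1 := by
    intro x _ hx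
    rcases hLs x with ⟨j, hj, h1 | ⟨h1, h2, h3⟩⟩ | ⟨h1, h2⟩
    · exact Or.inl ⟨j, hj, h1⟩
    · have := hZpar j hj; omega
    · rw [if_neg (by omega)] at h1
      exact Or.inr ⟨h1, fun j hj hlt he => h2 j hj _ (Or.inl ⟨hlt, he, rfl⟩)⟩
  have hRo : ∀ x < n, x % 2 = 1 → (∃ j ∈ Z, j < ch j ∧ x + 1 = ch j ∧ R x = ch x) ∨
      R x = (if x + 1 = n then 0 else x + 1) ∧ ∀ j ∈ Z, j < ch j → x + 1 ≠ ch j := by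
    intro x _ hx
    rcases hRs x with ⟨j, hj, ⟨h1, h2, h3⟩ | h1⟩ | ⟨h1, h2⟩
    · have := hZpar j hj; omega
    · exact Or.inl ⟨j, hj, h1⟩
    · exact Or.inr ⟨h1, fun j hj hlt he => h2 j hj _ (Or.inr ⟨hlt, he, rfl⟩)⟩
  clear hLs hRs hspec
  -- The exchange at the predecessor of `j` on `Z` takes a link away from `j` and puts the chord of
  -- `j` in its place.
  have hto : ∀ j ∈ Z, L j = ch j ∨ R j = ch j := by
    intro j hj
    obtain ⟨i, hi, hij⟩ := hZsurj j hj
    obtain ⟨hjn, hjo⟩ := hZodd j hj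
    rcases hfd i hi with ⟨h1, h2⟩ | ⟨h1, h2⟩
    · rcases hLo j hjn hjo with ⟨_, _, _, _, h3⟩ | ⟨_, h3⟩
      · exact Or.inl h3
      · exact absurd (hij.symm.trans h2) (h3 i hi h1)
    · rcases hRo j hjn hjo with ⟨_, _, _, _, h3⟩ | ⟨_, h3⟩
      · exact Or.inr h3
      · exact absurd (by rw [← hij]; exact h2) (h3 i hi h1)
  -- Two chords that reach an even position from the same side have the same step. By injectivity
  -- they coincide, so no other chord takes the place of the one at `j`.
  have hfrom : ∀ j ∈ Z, j = L (ch j) ∨ j = R (ch j) := by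
    intro j hj
    have hc := hZch j hj
    rcases hfd j hj with ⟨h1, h2⟩ | ⟨h1, h2⟩
    · rcases hRe _ hc.1 (hZpar j hj) with ⟨i, hi, h3, h4, h5⟩ | ⟨_, h3⟩
      · right
        rw [h5]
        refine hZinj _ hj _ hi ?_
        rcases hfd i hi with h6 | h6 <;> omega
      · exact absurd rfl (h3 j hj h1)
    · rcases hLe _ hc.1 (hZpar j hj) with ⟨i, hi, h3, h4, h5⟩ | ⟨_, h3⟩
      · left
        rw [h5]
        refine hZinj _ hj _ hi ?_
        rcases hfd i hi with h6 | h6 <;> omega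
      · exact absurd rfl (h3 j hj h1)
  have hstep : ∀ j ∈ Z, ch j < j → ch j + 1 ∈ Z := fun j hj hlt => by
    have := hZf j hj
    rcases hfd j hj with h1 | h1
    · rwa [h1.2] at this
    · omega
  have hstep' : ∀ j ∈ Z, j < ch j → ∀ x, x + 1 = ch j → x ∈ Z := fun j hj hlt x hx => by
    have := hZf j hj
    rcases hfd j hj with h1 | h1
    · omega
    · rwa [show f j = x by omega] at this
  have hprev : ∀ x < n, 0 < x → G.Adj (p x) (p (x - 1)) := by
    intro x hx hx0
    have := h.adj_succ (x - 1) (by omega)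
    rw [Nat.sub_add_cancel (by omega)] at this
    exact this.symm
  refine ⟨⟨?_, ?_, ?_, ?_, ?_, ?_, ?_, ?_⟩, ?_⟩
  · intro x hx
    rcases Nat.mod_two_eq_zero_or_one x with hp | hp
    · rcases hLe x hx hp with ⟨j, hj, _, _, h1⟩ | ⟨h1, _⟩
      · rw [h1]; exact (hZodd j hj).1
      · rw [h1]; split_ifs <;> omega
    · rcases hLo x hx hp with ⟨j, hj, _, _, h1⟩ | ⟨h1, _⟩
      · rw [h1]; exact (hch x hx hp).1
      · omega
  · intro x hx
    rcases Nat.mod_two_eq_zero_or_one x with hp | hp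
    · rcases hRe x hx hp with ⟨j, hj, _, _, h1⟩ | ⟨h1, _⟩
      · rw [h1]; exact (hZodd j hj).1
      · omega
    · rcases hRo x hx hp with ⟨j, hj, _, _, h1⟩ | ⟨h1, _⟩
      · rw [h1]; exact (hch x hx hp).1
      · rw [h1]; split_ifs <;> omega
  · intro x hx
    rcases Nat.mod_two_eq_zero_or_one x with hp | hp
    · rcases hLe x hx hp with ⟨j, hj, h2, h3, h1⟩ | ⟨h1, _⟩ <;>
        rcases hRe x hx hp with ⟨j', hj', h2', h3', h1'⟩ | ⟨h1', _⟩
      · omega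
      · omega
      · have := (hZch j' hj').2.2
        split_ifs at h1 <;> omega
      · split_ifs at h1 <;> omega
    · have hc := (hch x hx hp).2.2
      rcases hLo x hx hp with ⟨j, hj, h2, h3, h1⟩ | ⟨h1, _⟩ <;>
        rcases hRo x hx hp with ⟨j', hj', h2', h3', h1'⟩ | ⟨h1', _⟩
      -- An odd position cannot lose both links: the two exchanges would have the same step, hence
      -- be the same exchange, but their chords go in opposite directions.
      · have : j = j' := hZinj _ hj _ hj' (by
          rcases hfd j hj with h6 | h6 <;> rcases hfd j' hj' with h7 | h7 <;> omega)
        subst this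
        omega
      · split_ifs at h1' <;> omega
      · omega
      · split_ifs at h1' <;> omega
  · intro x hx
    rcases Nat.mod_two_eq_zero_or_one x with hp | hp
    · rcases hLe x hx hp with ⟨j, hj, h2, h3, h1⟩ | ⟨h1, _⟩
      · rw [h1, h3]; exact (hZch j hj).2.1.symm
      · rw [h1]
        split_ifs with h0
        · rw [h0]; exact h.adj_last.symm
        · exact hprev x hx (by omega)
    · rcases hLo x hx hp with ⟨j, hj, h2, h3, h1⟩ | ⟨h1, _⟩
      · rw [h1]; exact (hch x hx hp).2.1
      · rw [h1]; exact hprev x hx (by omega)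
  · intro x hx
    rcases Nat.mod_two_eq_zero_or_one x with hp | hp
    · rcases hRe x hx hp with ⟨j, hj, h2, h3, h1⟩ | ⟨h1, _⟩
      · rw [h1, h3]; exact (hZch j hj).2.1.symm
      · rw [h1]; exact h.adj_succ x (by omega)
    · rcases hRo x hx hp with ⟨j, hj, h2, h3, h1⟩ | ⟨h1, _⟩
      · rw [h1]; exact (hch x hx hp).2.1
      · rw [h1]
        split_ifs with h0
        · rw [show x = n - 1 by omega]; exact h.adj_last
        · exact h.adj_succ x (by omega)
  · intro x hx y hy hxy
    rcases Nat.mod_two_eq_zero_or_one x with hp | hp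
    · rcases hxy with hxy | hxy
      · rcases hLe x hx hp with ⟨j, hj, h2, h3, h1⟩ | ⟨h1, h2⟩
        · rw [hxy, h1, h3]
          exact (hto j hj).imp Eq.symm Eq.symm
        · right
          rcases hRo y hy (by split_ifs at h1 <;> omega) with ⟨j, hj, h4, h5, h6⟩ | ⟨h4, _⟩
          · have := h2 j hj h4
            have := (hZch j hj).1
            split_ifs at h1 <;> omega
          · split_ifs at h1 h4 <;> omega
      · rcases hRe x hx hp with ⟨j, hj, h2, h3, h1⟩ | ⟨h1, h2⟩
        · rw [hxy, h1, h3]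
          exact (hto j hj).imp Eq.symm Eq.symm
        · left
          rcases hLo y hy (by omega) with ⟨j, hj, h4, h5, h6⟩ | ⟨h4, _⟩
          · have := h2 j hj h4
            omega
          · omega
    · rcases hxy with hxy | hxy
      · rcases hLo x hx hp with ⟨j, hj, h2, h3, h1⟩ | ⟨h1, h2⟩
        · rw [hxy, h1]
          refine hfrom x ?_
          rw [h3]
          exact hstep j hj h2
        · right
          rcases hRe y hy (by omega) with ⟨j, hj, h4, h5, h6⟩ | ⟨h4, _⟩
          · have := h2 j hj h4
            omega
          · omega
      · rcases hRo x hx hp with ⟨j, hj, h2, h3, h1⟩ | ⟨h1, h2⟩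
        · rw [hxy, h1]
          exact hfrom x (hstep' j hj h2 x h3)
        · left
          rcases hLe y hy (by split_ifs at h1 <;> omega) with ⟨j, hj, h4, h5, h6⟩ | ⟨h4, _⟩
          · have := h2 j hj h4
            split_ifs at h1 <;> omega
          · split_ifs at h1 h4 <;> omega
  · intro x hx hp hx0
    constructor
    · rcases hLe x hx hp with ⟨j, hj, h2, h3, h1⟩ | ⟨h1, _⟩
      · omega
      · split_ifs at h1 <;> omega
    · rcases hRe x hx hp with ⟨j, hj, h2, h3, h1⟩ | ⟨h1, _⟩ <;> omega
  -- No chord reaches the position `0` from a smaller one, so the link across the ends is never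
  -- exchanged.
  · rcases hLe 0 (by omega) rfl with ⟨j, hj, h2, h3, h1⟩ | ⟨h1, _⟩
    · omega
    · rw [h1, if_pos rfl]
  · have hz : f^[n + 0] 1 ∈ Z := ⟨0, by omega, rfl⟩
    exact ⟨_, (hZodd _ hz).1, (hZodd _ hz).2, hto _ hz⟩

end IsHamOrder

end SimpleGraph

/-! ### Rules for time-bounded execution on the word RAM. -/

namespace WordRAM

/-- The program halts after at most `T` steps, in a store that satisfies `Q`. -/
def Ends (B : ℕ) (p : Program) (T : ℕ) (s : Store) (Q : Store → Prop) : Prop :=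
  ∃ (t : ℕ) (s' : Store), t ≤ T ∧ Run B p s t s' ∧ Q s'

theorem Ends.mono {B : ℕ} {p : Program} {T T' : ℕ} {s : Store} {Q Q' : Store → Prop}
    (h : Ends B p T s Q) (hT : T ≤ T') (hQ : ∀ s', Q s' → Q' s') : Ends B p T' s Q' := by
  obtain ⟨t, s', ht, hr, hq⟩ := h
  exact ⟨t, s', ht.trans hT, hr, hQ s' hq⟩

theorem Ends.seq {B : ℕ} {p q : Program} {T₁ T₂ : ℕ} {s : Store} {R Q : Store → Prop}
    (hp : Ends B p T₁ s R) (hq : ∀ s', R s' → Ends B q T₂ s' Q) :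
    Ends B (.seq p q) (T₁ + T₂) s Q := by
  obtain ⟨t, s', ht, hr, h⟩ := hp
  obtain ⟨t', s'', ht', hr', h'⟩ := hq s' h
  exact ⟨t + t', s'', Nat.add_le_add ht ht', .seq _ _ _ _ _ _ _ hr hr', h'⟩

/-- A loop with `N` rounds, of which the round `k` takes at most `c k` steps. -/
theorem Ends.whileLt {B : ℕ} {e f : Expr} {p : Program} (I : ℕ → Store → Prop) (N : ℕ) (c : ℕ → ℕ)
    {s : Store} (h0 : I 0 s)
    (hfits : ∀ k ≤ N, ∀ s, I k s → e.Fits B s ∧ f.Fits B s ∧ (e.eval s < f.eval s ↔ k < N))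
    (hbody : ∀ k < N, ∀ s, I k s → Ends B p (c k) s (I (k + 1))) :
    Ends B (.whileLt e f p)
      (∑ k ∈ Finset.range N, (c k + (e.cost + f.cost + 1)) + (e.cost + f.cost + 1)) s (I N) := by
  induction N generalizing I c s with
  | zero =>
    obtain ⟨he, hf, hlt⟩ := hfits 0 le_rfl s h0
    exact ⟨_, s, by simp, .whileLt_false _ _ _ _ he hf (by simp [hlt]), h0⟩
  | succ N ih =>
    obtain ⟨he, hf, hlt⟩ := hfits 0 (Nat.zero_le _) s h0
    obtain ⟨t, s', ht, hr, h'⟩ := hbody 0 (Nat.succ_pos N) s h0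
    obtain ⟨t', s'', ht', hr', h''⟩ := ih (fun k => I (k + 1)) (fun k => c (k + 1)) h'
      (fun k hk s hs => by simpa using hfits (k + 1) (by omega) s hs)
      (fun k hk s hs => hbody (k + 1) (by omega) s hs)
    refine ⟨_, s'', ?_, .whileLt_true _ _ _ _ _ _ _ _ he hf (by simp [hlt]) hr hr', h''⟩
    rw [Finset.sum_range_succ']
    omega

/-- The weakest precondition of a program without loops. -/
def Program.wp (B : ℕ) : Program → (Store → Prop) → Store → Prop
  | .skip, Q, s => Q s
  | .assign i e, Q, s => e.Fits B s ∧ Q { s with reg := Function.update s.reg i (e.eval s) }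
  | .store a e f, Q, s => e.Fits B s ∧ f.Fits B s ∧
      Q { s with mem := Function.update s.mem a (Function.update (s.mem a) (e.eval s) (f.eval s)) }
  | .seq p q, Q, s => p.wp B (q.wp B Q) s
  | .ifLt e f p q, Q, s => e.Fits B s ∧ f.Fits B s ∧
      (e.eval s < f.eval s → p.wp B Q s) ∧ (¬ e.eval s < f.eval s → q.wp B Q s)
  | .whileLt _ _ _, _, _ => False

/-- The maximal number of steps of a program without loops. -/
def Program.time : Program → ℕ
  | .skip => 1
  | .assign _ e => e.cost + 1
  | .store _ e f => e.cost + f.cost + 1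
  | .seq p q => p.time + q.time
  | .ifLt e f p q => e.cost + f.cost + 1 + (p.time + q.time)
  | .whileLt _ _ _ => 0

theorem Ends.of_wp {B : ℕ} {p : Program} {s : Store} {Q : Store → Prop} (h : p.wp B Q s) :
    Ends B p p.time s Q := by
  induction p generalizing s Q with
  | skip => exact ⟨_, _, le_rfl, .skip s, h⟩
  | assign i e => exact ⟨_, _, le_rfl, .assign i e s h.1, h.2⟩
  | store a e f => exact ⟨_, _, le_rfl, .store a e f s h.1 h.2.1, h.2.2⟩
  | seq p q ihp ihq => exact (ihp h).seq fun s' hs' => ihq hs'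
  | ifLt e f p q ihp ihq =>
    obtain ⟨he, hf, h1, h2⟩ := h
    by_cases hlt : e.eval s < f.eval s
    · obtain ⟨t, s', ht, hr, h'⟩ := ihp (h1 hlt)
      exact ⟨_, s', by simp only [Program.time]; omega, .ifLt_true _ _ _ _ _ _ _ he hf hlt hr, h'⟩
    · obtain ⟨t, s', ht, hr, h'⟩ := ihq (h2 hlt)
      exact ⟨_, s', by simp only [Program.time]; omega, .ifLt_false _ _ _ _ _ _ _ he hf hlt hr, h'⟩
  | whileLt => exact h.elim

end WordRAM

/-! ### The program, and the preparation of the rotated cycle. -/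

namespace WordRAM

open Program WordRAM.Expr

/-- The positions of the vertices in the input list of the cycle. -/
def indexLoop : Program :=
  .whileLt (reg 2) (reg 0) (.seq (.store 3 (cell 0 (add (reg 2) (const 3))) (reg 2))
    (.assign 2 (add (reg 2) (const 1))))

/-- The position that follows the first end of the edge in the cyclic order. -/
def findStart : Program :=
  .seq (.assign 3 (cell 3 (cell 0 (const 1)))) <|
  .seq (.assign 4 (cell 3 (cell 0 (const 2)))) <|
  .seq (.ifLt (reg 3) (reg 4)
    (.ifLt (add (reg 3) (const 1)) (reg 4) (.assign 1 (const 0)) (.assign 1 (reg 4)))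
    (.ifLt (add (reg 4) (const 1)) (reg 3) (.assign 1 (const 0)) (.assign 1 (reg 3)))) <|
  .assign 2 (const 0)

/-- The rotated cycle, the positions of the vertices in it, and the links along it. -/
def rotateLoop : Program :=
  .whileLt (reg 2) (reg 0) <|
    .seq (.assign 3 (cell 0 (add (reg 1) (const 3)))) <|
    .seq (.store 2 (reg 2) (reg 3)) <|
    .seq (.store 3 (reg 3) (reg 2)) <|
    .seq (.store 5 (add (reg 2) (const 1)) (reg 2)) <|
    .seq (.store 6 (reg 2) (add (reg 2) (const 1))) <|
    .seq (.assign 1 (add (reg 1) (const 1))) <|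
    .seq (.ifLt (reg 1) (reg 0) .skip (.assign 1 (const 0))) <|
    .assign 2 (add (reg 2) (const 1))

/-- The links across the ends of the rotated cycle. -/
def closeLinks : Program :=
  .seq (.store 5 (const 0) (sub (reg 0) (const 1))) <|
  .seq (.store 6 (sub (reg 0) (const 1)) (const 0)) <|
  .seq (.assign 1 (add (reg 0) (const 3))) <|
  .assign 2 (const 0)

/-- The last chord in the list of the neighbours of a vertex. -/
def neighborLoop : Program :=
  .whileLt (reg 1) (reg 4) <|
    .seq (.assign 5 (cell 3 (cell 0 (reg 1)))) <|
    .seq (.ifLt (add (reg 5) (const 1)) (reg 3)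
      (.ifLt (add (reg 3) (const 1)) (add (reg 5) (reg 0)) (.store 4 (reg 3) (reg 5)) .skip)
      (.ifLt (add (reg 3) (const 1)) (reg 5) (.store 4 (reg 3) (reg 5)) .skip)) <|
    .assign 1 (add (reg 1) (const 1))

/-- A chord for each position. -/
def chordLoop : Program :=
  .whileLt (reg 2) (reg 0) <|
    .seq (.seq (.assign 3 (cell 3 (reg 2))) <|
      .seq (.assign 4 (add (add (reg 1) (cell 0 (reg 1))) (const 1))) <|
      .assign 1 (add (reg 1) (const 1))) <|
    .seq neighborLoop <|
    .assign 2 (add (reg 2) (const 1))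

/-- The walk along the chords up to a position on a cycle. -/
def walkLoop : Program :=
  .whileLt (reg 2) (reg 0) <|
    .seq (.assign 3 (cell 4 (reg 1))) <|
    .seq (.ifLt (reg 3) (reg 1) (.assign 1 (add (reg 3) (const 1)))
      (.assign 1 (sub (reg 3) (const 1)))) <|
    .assign 2 (add (reg 2) (const 1))

/-- The exchanges along the cycle of chords. -/
def toggleLoop : Program :=
  .whileLt (reg 2) (reg 0) <|
    .seq (.assign 3 (cell 4 (reg 1))) <|
    .seq (.ifLt (reg 3) (reg 1)
      (.seq (.store 6 (reg 3) (reg 1)) <|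
        .seq (.store 5 (add (reg 3) (const 1)) (cell 4 (add (reg 3) (const 1)))) <|
        .assign 1 (add (reg 3) (const 1)))
      (.seq (.store 5 (reg 3) (reg 1)) <|
        .seq (.store 6 (sub (reg 3) (const 1)) (cell 4 (sub (reg 3) (const 1)))) <|
        .assign 1 (sub (reg 3) (const 1)))) <|
    .assign 2 (add (reg 2) (const 1))

/-- The walk along the new cycle. -/
def outputLoop : Program :=
  .whileLt (reg 2) (reg 0) <|
    .seq (.store 1 (reg 2) (cell 2 (reg 1))) <|
    .seq (.assign 4 (cell 5 (reg 1))) <|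
    .seq (.ifLt (reg 4) (reg 3) .skip (.ifLt (reg 3) (reg 4) .skip (.assign 4 (cell 6 (reg 1))))) <|
    .seq (.assign 3 (reg 1)) <|
    .seq (.assign 1 (reg 4)) <|
    .assign 2 (add (reg 2) (const 1))

/-- The exchanges, given a chord for each position, and the output. -/
def exchange : Program :=
  .seq (.seq (.assign 1 (const 1)) (.assign 2 (const 0))) <|
  .seq walkLoop <|
  .seq (.assign 2 (const 0)) <|
  .seq toggleLoop <|
  .seq (.seq (.assign 1 (const 0)) <|
    .seq (.assign 3 (sub (reg 0) (const 1))) <| .assign 2 (const 0))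
  outputLoop

/-- Another Hamiltonian cycle through the given edge. -/
def anotherHamiltonianCycle : Program :=
  .seq (.seq (.assign 0 (cell 0 (const 0))) (.assign 2 (const 0))) <|
  .seq indexLoop <|
  .seq findStart <|
  .seq rotateLoop <|
  .seq closeLinks <|
  .seq chordLoop exchange

/-- The time of a loop with `N` rounds of constant time. -/
theorem Ends.whileLt_const {B : ℕ} {e f : Expr} {p : Program} (I : ℕ → Store → Prop) (N : ℕ)
    {s : Store} (h0 : I 0 s)
    (hfits : ∀ k ≤ N, ∀ s, I k s → e.Fits B s ∧ f.Fits B s ∧ (e.eval s < f.eval s ↔ k < N))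
    (hbody : ∀ k < N, ∀ s, I k s → p.wp B (I (k + 1)) s) :
    Ends B (.whileLt e f p) ((N + 1) * (p.time + (e.cost + f.cost + 1))) s (I N) := by
  refine (Ends.whileLt I N (fun _ => p.time) h0 hfits
    fun k hk s hs => .of_wp (hbody k hk s hs)).mono ?_ fun _ h => h
  rw [Finset.sum_const, Finset.card_range, smul_eq_mul]
  nlinarith


/-- Distinct entries of the cycle address distinct cells, so the array `3` inverts the part of the
cycle that has been read. -/
theorem indexLoop_ends {B n : ℕ} {I c : ℕ → ℕ} (hB : n + 5 < B) (hI : ∀ t < n, I (t + 3) = c t)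
    (hc : ∀ t < n, c t < n) (hinj : ∀ t < n, ∀ t' < n, c t = c t' → t = t')
    {s : Store} (h0 : s.reg 0 = n) (h2 : s.reg 2 = 0) (hm : s.mem 0 = I) :
    Ends B indexLoop ((n + 1) * 100) s fun s =>
      s.reg 0 = n ∧ s.mem 0 = I ∧ ∀ t < n, s.mem 3 (c t) = t := by
  refine (Ends.whileLt_const (fun k s => s.reg 0 = n ∧ s.reg 2 = k ∧ s.mem 0 = I ∧
    ∀ t < k, s.mem 3 (c t) = t) n ⟨h0, h2, hm, by simp⟩ ?_ ?_).mono ?_ ?_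
  · rintro k hk s ⟨h0, h2, hm, hp⟩
    exact ⟨by rw [Fits]; omega, by rw [Fits]; omega, by rw [eval, eval, h0, h2]⟩
  · rintro k hk s ⟨h0, h2, hm, hp⟩
    have := hc k hk
    simp only [wp, Fits, eval, h2, hm, hI k hk]
    refine ⟨by omega, by omega, by omega, by simpa using h0, by simp, by simpa using hm, ?_⟩
    intro t ht
    simp only [Function.update_self]
    by_cases htk : t = k
    · rw [htk, Function.update_self]
    · rw [Function.update_of_ne fun he => htk (hinj t (by omega) k hk he)]
      exact hp t (by omega)
  · exact Nat.mul_le_mul le_rfl (by decide)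
  · rintro s ⟨h0, -, hm, hp⟩
    exact ⟨h0, hm, hp⟩

/-- The ends of an edge of the cycle are consecutive in the list, and then the later one becomes the
start, or they are the first and the last entry, and then the list need not be rotated. -/
theorem findStart_ends {B n : ℕ} {I c : ℕ → ℕ} (hB : n + 5 < B) {a b : ℕ}
    (ha : a < n) (hb : b < n) (hI1 : I 1 = c a) (hI2 : I 2 = c b) (hc : ∀ t < n, c t < n)
    {s : Store} (h0 : s.reg 0 = n) (hm : s.mem 0 = I) (hp : ∀ t < n, s.mem 3 (c t) = t) :
    Ends B findStart 100 s fun s => s.reg 0 = n ∧ s.mem 0 = I ∧ s.reg 2 = 0 ∧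
      s.reg 1 = if a < b then (if a + 1 < b then 0 else b) else if b + 1 < a then 0 else a := by
  refine (Ends.of_wp ?_).mono (T := findStart.time) (by decide) fun _ h => h
  have := hc a ha
  have := hc b hb
  simp [findStart, wp, Fits, eval, hm, hI1, hI2, hp _ ha, hp _ hb, h0]
  split_ifs <;> omega

theorem rotateLoop_ends {B n st : ℕ} {I c : ℕ → ℕ} (hB : n + 5 < B)
    (hI : ∀ t < n, I (t + 3) = c t) (hst : st < n)
    (hc : ∀ t < n, c t < n) (hinj : ∀ t < n, ∀ t' < n, c t = c t' → t = t')
    {s : Store} (h0 : s.reg 0 = n) (h1 : s.reg 1 = st) (h2 : s.reg 2 = 0) (hm : s.mem 0 = I) :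
    Ends B rotateLoop ((n + 1) * 100) s fun s => s.reg 0 = n ∧ s.mem 0 = I ∧
      (∀ t < n, s.mem 2 t = c ((st + t) % n) ∧ s.mem 3 (c ((st + t) % n)) = t ∧
        s.mem 5 (t + 1) = t ∧ s.mem 6 t = t + 1) := by
  refine (Ends.whileLt_const (fun k s => s.reg 0 = n ∧ s.reg 1 = (st + k) % n ∧ s.reg 2 = k ∧
    s.mem 0 = I ∧ (∀ t < k, s.mem 2 t = c ((st + t) % n) ∧ s.mem 3 (c ((st + t) % n)) = t ∧
        s.mem 5 (t + 1) = t ∧ s.mem 6 t = t + 1)) n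
    ⟨h0, by rw [h1, Nat.add_zero, Nat.mod_eq_of_lt hst], h2, hm, by simp⟩ ?_ ?_).mono ?_ ?_
  · rintro k hk s ⟨h0, h1, h2, hm, hp⟩
    exact ⟨by rw [Fits]; omega, by rw [Fits]; omega, by rw [eval, eval, h0, h2]⟩
  · rintro k hk s ⟨h0, h1, h2, hm, hp⟩
    have hlt : (st + k) % n < n := Nat.mod_lt _ (by omega)
    have hck := hc _ hlt
    have hI' := hI _ hlt
    -- The machine has no remainder operation; the index wraps around by a comparison with `n`.
    have hmod : (st + (k + 1)) % n = if (st + k) % n + 1 < n then (st + k) % n + 1 else 0 := by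
      rw [← Nat.add_assoc, Nat.add_mod]
      split_ifs with h
      · rw [Nat.mod_eq_of_lt (a := 1) (by omega), Nat.mod_eq_of_lt h]
      · by_cases hn1 : n = 1
        · rw [hn1, Nat.mod_one]
        · rw [Nat.mod_eq_of_lt (a := 1) (by omega), show (st + k) % n + 1 = n by omega,
            Nat.mod_self]
    have key : ∀ t < k, c ((st + t) % n) ≠ c ((st + k) % n) := by
      intro t ht he
      have h1 := hinj _ (Nat.mod_lt _ (by omega)) _ hlt he
      have h2 : t ≡ k [MOD n] := Nat.ModEq.add_left_cancel' st h1
      have := h2.eq_of_lt_of_lt (by omega) hk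
      omega
    simp [wp, Fits, eval, h0, h1, h2, hm, hI', Function.update_apply, hmod]
    refine ⟨by omega, by omega, by omega, by omega, by omega, by omega, by omega, by omega,
      by omega, by omega, fun h => ⟨by omega, h, fun t ht => ?_⟩,
      fun h => ⟨by omega, by omega, h, fun t ht => ?_⟩⟩ <;>
    · rcases ht.lt_or_eq with ht | rfl
      · have := hp t ht
        simp [ht.ne, key t ht, this]
      · simp
  · exact Nat.mul_le_mul le_rfl (by decide)
  · rintro s ⟨h0, -, -, hm, hp⟩
    exact ⟨h0, hm, hp⟩

/-- The rotation does not write the left link of `0`, and it writes `n` as the right link of `n -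
1`; both are corrected here. The address `n + 3` is that of the first adjacency list, after `n`, the
two ends of the edge and the cycle. -/
theorem closeLinks_ends {B n : ℕ} {I P : ℕ → ℕ} (hn : 0 < n) (hB : n + 5 < B)
    {s : Store} (h0 : s.reg 0 = n) (hm : s.mem 0 = I)
    (hs : ∀ t < n, s.mem 2 t = P t ∧ s.mem 3 (P t) = t ∧ s.mem 5 (t + 1) = t ∧
      s.mem 6 t = t + 1) :
    Ends B closeLinks 100 s fun s => s.reg 0 = n ∧ s.mem 0 = I ∧ s.reg 1 = n + 3 ∧ s.reg 2 = 0 ∧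
      ∀ t < n, s.mem 2 t = P t ∧ s.mem 3 (P t) = t ∧
        s.mem 5 t = (if t = 0 then n - 1 else t - 1) ∧
        s.mem 6 t = if t + 1 = n then 0 else t + 1 := by
  refine (Ends.of_wp ?_).mono (T := closeLinks.time) (by decide) fun _ h => h
  simp [closeLinks, wp, Fits, eval, hm, h0, Function.update_apply]
  refine ⟨by omega, by omega, by omega, by omega, by omega, fun t ht => ?_⟩
  obtain ⟨h1, h2, h3, h4⟩ := hs t ht
  refine ⟨h1, h2, ?_, ?_⟩
  · split_ifs with h
    · rfl
    · have := (hs (t - 1) (by omega)).2.2.1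
      rwa [Nat.sub_add_cancel (by omega)] at this
  · rw [h4]
    split_ifs <;> omega

end WordRAM

/-! ### Finding a chord at each position. -/

namespace WordRAM

open Program WordRAM.Expr

/-- The positions `j` and `i` are not consecutive in the cyclic order of length `n`. -/
def Apart (n j i : ℕ) : Prop := i + 1 < j ∧ j + 1 < i + n ∨ j + 1 < i

/-- The array `ch` holds a chord for the position of the vertex `w`, if `w` has one. The position
of `w` is `Q w`, and its neighbours are `nb w 0, …, nb w (d w - 1)`. -/
def HoldsChord (n : ℕ) (d : ℕ → ℕ) (nb : ℕ → ℕ → ℕ) (Q ch : ℕ → ℕ) (w : ℕ) : Prop :=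
  (∃ k < d w, Apart n (Q w) (Q (nb w k))) →
    ∃ k < d w, ch (Q w) = Q (nb w k) ∧ Apart n (Q w) (ch (Q w))

/-- A later chord may overwrite an earlier one at the same position, but injectivity of `Q` protects
the entries of the other vertices. The bound on `2 * n` leaves room for the sum of a position and
`n` in the cyclic test. -/
theorem neighborLoop_ends {B n w : ℕ} {I Q M₂ M₅ M₆ off d : ℕ → ℕ} {nb : ℕ → ℕ → ℕ}
    (hw : w < n) (hB : 2 * n + 5 < B) (hoffB : off w + d w + 1 < B)
    (hnb : ∀ k < d w, I (off w + 1 + k) = nb w k ∧ nb w k < n)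
    (hQ : ∀ w < n, Q w < n) (hQinj : ∀ w < n, ∀ w' < n, Q w = Q w' → w = w')
    {s : Store} (h : s.reg 0 = n ∧ s.reg 2 = w ∧ s.reg 1 = off w + 1 ∧ s.reg 3 = Q w ∧
      s.reg 4 = off w + d w + 1 ∧ s.mem 0 = I ∧ s.mem 3 = Q ∧ s.mem 2 = M₂ ∧ s.mem 5 = M₅ ∧
      s.mem 6 = M₆ ∧ ∀ v < w, HoldsChord n d nb Q (s.mem 4) v) :
    Ends B neighborLoop ((d w + 1) * 100) s fun s =>
      s.reg 0 = n ∧ s.reg 2 = w ∧ s.reg 1 = off w + 1 + d w ∧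
      s.mem 0 = I ∧ s.mem 3 = Q ∧ s.mem 2 = M₂ ∧ s.mem 5 = M₅ ∧
      s.mem 6 = M₆ ∧ ∀ v < w + 1, HoldsChord n d nb Q (s.mem 4) v := by
  obtain ⟨h0, h2, h1, h3, h4, m0, m3, m2, m5, m6, hch⟩ := h
  refine (Ends.whileLt_const (fun k s =>
      s.reg 0 = n ∧ s.reg 2 = w ∧ s.reg 1 = off w + 1 + k ∧ s.reg 3 = Q w ∧
      s.reg 4 = off w + d w + 1 ∧ s.mem 0 = I ∧ s.mem 3 = Q ∧ s.mem 2 = M₂ ∧ s.mem 5 = M₅ ∧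
      s.mem 6 = M₆ ∧ (∀ v < w, HoldsChord n d nb Q (s.mem 4) v) ∧
      ((∃ k' < k, Apart n (Q w) (Q (nb w k'))) →
        ∃ k' < d w, s.mem 4 (Q w) = Q (nb w k') ∧ Apart n (Q w) (s.mem 4 (Q w)))) (d w)
    ⟨h0, h2, h1, h3, h4, m0, m3, m2, m5, m6, hch, by simp⟩ ?_ ?_).mono ?_ ?_
  · rintro k hk s ⟨h0, h2, h1, h3, h4, -⟩
    exact ⟨by rw [Fits]; omega, by rw [Fits]; omega, by rw [eval, eval, h1, h4]; omega⟩
  · rintro k hk s ⟨h0, h2, h1, h3, h4, m0, m3, m2, m5, m6, hch, hk'⟩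
    obtain ⟨e1, e2⟩ := hnb k hk
    have e3 := hQ _ e2
    have e4 := hQ _ hw
    have keep : ∀ v < w, HoldsChord n d nb Q
        (fun j => if j = Q w then Q (nb w k) else s.mem 4 j) v := by
      intro v hv
      have hne : Q v ≠ Q w := fun he => hv.ne (hQinj v (by omega) w hw he)
      simpa only [HoldsChord, if_neg hne] using hch v hv
    have skip : ¬ Apart n (Q w) (Q (nb w k)) → (∃ k' < k + 1, Apart n (Q w) (Q (nb w k'))) →
        ∃ k' < d w, s.mem 4 (Q w) = Q (nb w k') ∧ Apart n (Q w) (s.mem 4 (Q w)) := by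
      rintro hn ⟨k', h1, h2⟩
      rcases Nat.lt_succ_iff_lt_or_eq.1 h1 with h1 | rfl
      · exact hk' ⟨k', h1, h2⟩
      · exact absurd h2 hn
    have hupd : Function.update (s.mem 4) (Q w) (Q (nb w k))
        = fun j => if j = Q w then Q (nb w k) else s.mem 4 j := by
      funext j; rw [Function.update_apply]
    simp only [wp, Fits, eval, h0, h1, h2, h3, h4, m0, m3, e1, Function.update_self,
      Function.update_of_ne (show (3 : ℕ) ≠ 5 by decide),
      Function.update_of_ne (show (0 : ℕ) ≠ 5 by decide),
      Function.update_of_ne (show (1 : ℕ) ≠ 5 by decide),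
      Function.update_of_ne (show (2 : ℕ) ≠ 5 by decide),
      Function.update_of_ne (show (4 : ℕ) ≠ 5 by decide),
      Function.update_of_ne (show (0 : ℕ) ≠ 1 by decide),
      Function.update_of_ne (show (2 : ℕ) ≠ 1 by decide),
      Function.update_of_ne (show (3 : ℕ) ≠ 1 by decide),
      Function.update_of_ne (show (4 : ℕ) ≠ 1 by decide),
      Function.update_of_ne (show (0 : ℕ) ≠ 4 by decide),
      Function.update_of_ne (show (2 : ℕ) ≠ 4 by decide),
      Function.update_of_ne (show (3 : ℕ) ≠ 4 by decide),
      Function.update_of_ne (show (5 : ℕ) ≠ 4 by decide),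
      Function.update_of_ne (show (6 : ℕ) ≠ 4 by decide), m2, m5, m6, hupd]
    have fin : Apart n (Q w) (Q (nb w k)) →
        ∃ k' < d w, Q (nb w k) = Q (nb w k') ∧ Apart n (Q w) (Q (nb w k)) :=
      fun hA => ⟨k, hk, rfl, hA⟩
    refine ⟨by omega, by omega, by omega, fun c1 => ⟨by omega, by omega, fun c2 => ?_, fun c2 => ?_⟩,
      fun c1 => ⟨by omega, by omega, fun c2 => ?_, fun c2 => ?_⟩⟩
    · exact ⟨by omega, by omega, by omega, trivial, trivial, by omega, trivial, trivial, trivial,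
        trivial, trivial, trivial, trivial, keep, fun _ => by
          simpa only [if_true] using fin (Or.inl ⟨c1, c2⟩)⟩
    · exact ⟨by omega, trivial, trivial, by omega, trivial, trivial, trivial,
        trivial, trivial, trivial, trivial, hch, skip (by unfold Apart; omega)⟩
    · exact ⟨by omega, by omega, by omega, trivial, trivial, by omega, trivial, trivial, trivial,
        trivial, trivial, trivial, trivial, keep, fun _ => by
          simpa only [if_true] using fin (Or.inr c2)⟩
    · exact ⟨by omega, trivial, trivial, by omega, trivial, trivial, trivial,
        trivial, trivial, trivial, trivial, hch, skip (by unfold Apart; omega)⟩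
  · exact Nat.mul_le_mul le_rfl (by decide)
  · rintro s ⟨h0, h2, h1, h3, h4, m0, m3, m2, m5, m6, hch, hk'⟩
    refine ⟨h0, h2, h1, m0, m3, m2, m5, m6, fun v hv => ?_⟩
    rcases Nat.lt_succ_iff_lt_or_eq.1 hv with hv | rfl
    · exact hch v hv
    · exact hk'

/-- The block of the next vertex begins where the scan of the previous one stops, so each list is
scanned once and the time is linear in `n` plus the sum of the degrees. -/
theorem chordLoop_ends {B n : ℕ} {I Q M₂ M₅ M₆ off d : ℕ → ℕ} {nb : ℕ → ℕ → ℕ}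
    (hB : 2 * n + 5 < B) (hoffB : ∀ w < n, off w + d w + 1 < B) (hoff0 : off 0 = n + 3)
    (hoff : ∀ w < n, off (w + 1) = off w + 1 + d w)
    (hd : ∀ w < n, I (off w) = d w)
    (hnb : ∀ w < n, ∀ k < d w, I (off w + 1 + k) = nb w k ∧ nb w k < n)
    (hQ : ∀ w < n, Q w < n) (hQinj : ∀ w < n, ∀ w' < n, Q w = Q w' → w = w')
    {s : Store} (h0 : s.reg 0 = n) (h1 : s.reg 1 = n + 3) (h2 : s.reg 2 = 0) (m0 : s.mem 0 = I)
    (m3 : s.mem 3 = Q) (m2 : s.mem 2 = M₂) (m5 : s.mem 5 = M₅) (m6 : s.mem 6 = M₆) :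
    Ends B chordLoop (300 * (n + 1) + 100 * ∑ w ∈ Finset.range n, d w) s fun s =>
      s.reg 0 = n ∧ s.mem 2 = M₂ ∧ s.mem 5 = M₅ ∧ s.mem 6 = M₆ ∧
      ∀ w < n, HoldsChord n d nb Q (s.mem 4) w := by
  refine (Ends.whileLt (fun w s => s.reg 0 = n ∧ s.reg 2 = w ∧ s.reg 1 = off w ∧
      s.mem 0 = I ∧ s.mem 3 = Q ∧ s.mem 2 = M₂ ∧ s.mem 5 = M₅ ∧
      s.mem 6 = M₆ ∧ ∀ v < w, HoldsChord n d nb Q (s.mem 4) v) n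
      (fun w => (d w + 1) * 100 + 50)
      ⟨h0, h2, by rw [h1, hoff0], m0, m3, m2, m5, m6, by simp⟩ ?_ ?_).mono ?_ ?_
  · rintro k hk s ⟨h0, h2, -⟩
    exact ⟨by rw [Fits]; omega, by rw [Fits]; omega, by rw [eval, eval, h0, h2]⟩
  · rintro w hw s ⟨h0, h2, h1, m0, m3, m2, m5, m6, hch⟩
    have b1 := hoffB w hw
    have b2 := hQ w hw
    have b3 := hd w hw
    refine (Ends.seq (Ends.of_wp (Q := fun s => s.reg 0 = n ∧ s.reg 2 = w ∧ s.reg 1 = off w + 1 ∧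
      s.reg 3 = Q w ∧ s.reg 4 = off w + d w + 1 ∧ s.mem 0 = I ∧ s.mem 3 = Q ∧ s.mem 2 = M₂ ∧
      s.mem 5 = M₅ ∧ s.mem 6 = M₆ ∧ ∀ v < w, HoldsChord n d nb Q (s.mem 4) v) ?_)
      fun s' hs' => Ends.seq (neighborLoop_ends hw hB b1 (hnb w hw) hQ hQinj hs')
      fun s'' hs'' => Ends.of_wp ?_).mono ?_ fun _ h => h
    · simp [wp, Fits, eval, h0, h1, h2, m0, m3, m2, m5, m6, b3]
      exact ⟨by omega, by omega, by omega, hch⟩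
    · obtain ⟨h0, h2, h1, m0, m3, m2, m5, m6, hch⟩ := hs''
      simp only [wp, Fits, eval, h2]
      refine ⟨by omega, by simpa using h0, by simp, ?_, m0, m3, m2, m5, m6, hch⟩
      rw [hoff w hw]
      simpa using h1
    · simp only [Program.time, Expr.cost]
      omega
  · rw [Finset.mul_sum]
    have : ∀ N, ∑ k ∈ Finset.range N, ((d k + 1) * 100 + 50 + ((reg 2).cost + (reg 0).cost + 1))
        = 153 * N + ∑ w ∈ Finset.range N, 100 * d w := by
      intro N
      induction N with
      | zero => simp
      | succ N ih =>
        rw [Finset.sum_range_succ, Finset.sum_range_succ, ih]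
        simp only [Expr.cost]
        ring
    rw [this]
    simp only [Expr.cost]
    omega
  · rintro s ⟨h0, h2, h1, m0, m3, m2, m5, m6, hch⟩
    exact ⟨h0, m2, m5, m6, hch⟩

end WordRAM

/-! ### Running the exchanges and the output. -/

namespace WordRAM

open Program WordRAM.Expr SimpleGraph

/-- Bounds are needed only along the orbit of `1`; nothing is assumed about the other cells of `ch`.
-/
theorem walkLoop_ends {B n : ℕ} {ch M₂ M₅ M₆ : ℕ → ℕ} (hB : n + 5 < B)
    (horb : ∀ t, (chordStep ch)^[t] 1 < n ∧ ch ((chordStep ch)^[t] 1) < n)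
    {s : Store} (h0 : s.reg 0 = n) (h1 : s.reg 1 = 1) (h2 : s.reg 2 = 0)
    (m4 : s.mem 4 = ch) (m2 : s.mem 2 = M₂) (m5 : s.mem 5 = M₅) (m6 : s.mem 6 = M₆) :
    Ends B walkLoop ((n + 1) * 100) s fun s => s.reg 0 = n ∧ s.reg 1 = (chordStep ch)^[n] 1 ∧
      s.mem 4 = ch ∧ s.mem 2 = M₂ ∧ s.mem 5 = M₅ ∧ s.mem 6 = M₆ := by
  refine (Ends.whileLt_const (fun k s => s.reg 0 = n ∧ s.reg 1 = (chordStep ch)^[k] 1 ∧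
    s.reg 2 = k ∧ s.mem 4 = ch ∧ s.mem 2 = M₂ ∧ s.mem 5 = M₅ ∧ s.mem 6 = M₆) n
    ⟨h0, h1, h2, m4, m2, m5, m6⟩ ?_ ?_).mono ?_ ?_
  · rintro k hk s ⟨h0, -, h2, -⟩
    exact ⟨by rw [Fits]; omega, by rw [Fits]; omega, by rw [eval, eval, h0, h2]⟩
  · rintro k hk s ⟨h0, h1, h2, m4, m2, m5, m6⟩
    obtain ⟨b1, b2⟩ := horb k
    rw [Function.iterate_succ_apply']
    generalize (chordStep ch)^[k] 1 = j at *
    simp +contextual [wp, Fits, eval, h0, h1, h2, m4, m2, m5, m6, chordStep]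
    omega
  · exact Nat.mul_le_mul le_rfl (by decide)
  · rintro s ⟨h0, h1, h2, hm⟩
    exact ⟨h0, h1, hm⟩

theorem toggleLoop_ends {B n : ℕ} {ch M₂ : ℕ → ℕ} (hB : n + 5 < B)
    (horb : ∀ t, 0 < (chordStep ch)^[t] 1 ∧ (chordStep ch)^[t] 1 < n ∧
      ch ((chordStep ch)^[t] 1) < n)
    {s : Store} (h0 : s.reg 0 = n) (h1 : s.reg 1 = (chordStep ch)^[n] 1) (h2 : s.reg 2 = 0)
    (m4 : s.mem 4 = ch) (m2 : s.mem 2 = M₂)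
    (hs : ∀ x < n, s.mem 5 x = (toggles ch n 0).1 x ∧ s.mem 6 x = (toggles ch n 0).2 x) :
    Ends B toggleLoop ((n + 1) * 100) s fun s => s.reg 0 = n ∧ s.mem 2 = M₂ ∧
      ∀ x < n, s.mem 5 x = (toggles ch n n).1 x ∧ s.mem 6 x = (toggles ch n n).2 x := by
  refine (Ends.whileLt_const (fun k s => s.reg 0 = n ∧ s.reg 1 = (chordStep ch)^[n + k] 1 ∧
    s.reg 2 = k ∧ s.mem 4 = ch ∧ s.mem 2 = M₂ ∧
    ∀ x < n, s.mem 5 x = (toggles ch n k).1 x ∧ s.mem 6 x = (toggles ch n k).2 x) n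
    ⟨h0, h1, h2, m4, m2, hs⟩ ?_ ?_).mono ?_ ?_
  · rintro k hk s ⟨h0, -, h2, -⟩
    exact ⟨by rw [Fits]; omega, by rw [Fits]; omega, by rw [eval, eval, h0, h2]⟩
  · rintro k hk s ⟨h0, h1, h2, m4, m2, hs⟩
    obtain ⟨b0, b1, b2⟩ := horb (n + k)
    -- An exchange also copies the chord of the next position of the orbit, so the bounds are needed
    -- one step ahead.
    have b3 := (horb (n + (k + 1))).2
    rw [← Nat.add_assoc, Function.iterate_succ_apply', chordStep] at b3
    have hT : toggles ch n (k + 1) = toggle ch ((chordStep ch)^[n + k] 1) (toggles ch n k) := rfl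
    rw [← Nat.add_assoc, Function.iterate_succ_apply', hT]
    generalize (chordStep ch)^[n + k] 1 = j at *
    by_cases hlt : ch j < j
    · rw [if_pos hlt] at b3
      simp [wp, Fits, eval, h0, h1, h2, m4, m2, chordStep, toggle, hlt]
      refine ⟨by omega, by omega, by omega, by omega, by omega, by omega, by omega, by omega,
        by omega, fun x hx => ⟨?_, ?_⟩⟩ <;>
      · simp only [Function.update_apply, hs x hx]
    · rw [if_neg hlt] at b3
      simp [wp, Fits, eval, h0, h1, h2, m4, m2, chordStep, toggle, hlt]
      refine ⟨by omega, by omega, by omega, by omega, by omega, by omega, by omega, by omega,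
        by omega, fun x hx => ⟨?_, ?_⟩⟩ <;>
      · simp only [Function.update_apply, hs x hx]
  · exact Nat.mul_le_mul le_rfl (by decide)
  · rintro s ⟨h0, -, -, -, m2, hs⟩
    exact ⟨h0, m2, hs⟩

theorem outputLoop_ends {B n : ℕ} {P L R : ℕ → ℕ} (hn : 0 < n) (hB : n + 5 < B)
    (hL : ∀ x < n, L x < n) (hR : ∀ x < n, R x < n) (hP : ∀ x < n, P x < n)
    {s : Store} (h0 : s.reg 0 = n) (h1 : s.reg 1 = 0) (h2 : s.reg 2 = 0) (h3 : s.reg 3 = n - 1)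
    (hs : ∀ x < n, s.mem 2 x = P x ∧ s.mem 5 x = L x ∧ s.mem 6 x = R x) :
    Ends B outputLoop ((n + 1) * 100) s fun s => s.reg 0 = n ∧
      ∀ t < n, s.mem 1 t = P (IsTwoFactor.trav L R n t).2 := by
  refine (Ends.whileLt_const (fun k s => s.reg 0 = n ∧
    s.reg 1 = (IsTwoFactor.trav L R n k).2 ∧ s.reg 3 = (IsTwoFactor.trav L R n k).1 ∧
    (IsTwoFactor.trav L R n k).1 < n ∧ (IsTwoFactor.trav L R n k).2 < n ∧
    s.reg 2 = k ∧ (∀ x < n, s.mem 2 x = P x ∧ s.mem 5 x = L x ∧ s.mem 6 x = R x) ∧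
    ∀ t < k, s.mem 1 t = P (IsTwoFactor.trav L R n t).2) n
    ⟨h0, h1, h3, Nat.sub_lt hn one_pos, hn, h2, hs, by simp⟩ ?_ ?_).mono ?_ ?_
  · rintro k hk s ⟨h0, -, -, -, -, h2, -⟩
    exact ⟨by rw [Fits]; omega, by rw [Fits]; omega, by rw [eval, eval, h0, h2]⟩
  · rintro k hk s ⟨h0, h1, h3, b3, b1, h2, hs, ho⟩
    have ho' : ∀ t ≤ k, (if t = k then P (IsTwoFactor.trav L R n k).2 else s.mem 1 t)
        = P (IsTwoFactor.trav L R n t).2 := by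
      intro t ht
      split_ifs with h
      · rw [h]
      · exact ho t (by omega)
    simp only [IsTwoFactor.trav]
    generalize (IsTwoFactor.trav L R n k).2 = j at *
    generalize (IsTwoFactor.trav L R n k).1 = i at *
    obtain ⟨e1, e2, e3⟩ := hs j b1
    have := hL j b1
    have := hR j b1
    have := hP j b1
    -- The machine tests equality with the predecessor by two strict comparisons.
    rcases lt_trichotomy (L j) i with hlt | hlt | hlt
    · simp [wp, Fits, eval, h0, h1, h2, h3, e1, e2, e3, Function.update_apply, hlt, hlt.ne]
      exact ⟨by omega, by omega, by omega, by omega, by omega, by omega, by omega, by omega,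
        by omega, by omega, hs, ho'⟩
    · simp [wp, Fits, eval, h0, h1, h2, h3, e1, e2, e3, Function.update_apply, hlt]
      exact ⟨by omega, by omega, by omega, by omega, by omega, by omega, by omega, by omega,
        by omega, by omega, hs, ho'⟩
    · simp [wp, Fits, eval, h0, h1, h2, h3, e1, e2, e3, Function.update_apply, hlt, hlt.ne',
        not_lt.2 hlt.le]
      exact ⟨by omega, by omega, by omega, by omega, by omega, by omega, by omega, by omega,
        by omega, by omega, by omega, hs, ho'⟩
  · exact Nat.mul_le_mul le_rfl (by decide)
  · rintro s ⟨h0, -, -, -, -, -, -, ho⟩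
    exact ⟨h0, ho⟩

end WordRAM

/-! ### The whole program. -/

namespace WordRAM

open Program WordRAM.Expr SimpleGraph

theorem exchange_ends {B n : ℕ} {P ch : ℕ → ℕ} (hn : 0 < n) (hB : n + 5 < B)
    (hP : ∀ x < n, P x < n)
    (horb : ∀ t, 0 < (chordStep ch)^[t] 1 ∧ (chordStep ch)^[t] 1 < n ∧
      ch ((chordStep ch)^[t] 1) < n)
    (hlt : ∀ x < n, (toggles ch n n).1 x < n ∧ (toggles ch n n).2 x < n)
    {s : Store} (h0 : s.reg 0 = n) (m4 : s.mem 4 = ch)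
    (hs : ∀ t < n, s.mem 2 t = P t ∧ s.mem 5 t = (toggles ch n 0).1 t ∧
      s.mem 6 t = (toggles ch n 0).2 t) :
    Ends B exchange (300 * (n + 1) + 100) s fun s => s.reg 0 = n ∧
      ∀ t < n, s.mem 1 t
        = P (IsTwoFactor.trav (toggles ch n n).1 (toggles ch n n).2 n t).2 := by
  refine (Ends.seq (Ends.of_wp (Q := fun s => s.reg 0 = n ∧
        s.reg 1 = 1 ∧ s.reg 2 = 0 ∧ s.mem 4 = ch ∧ ∀ t < n, s.mem 2 t = P t ∧
          s.mem 5 t = (toggles ch n 0).1 t ∧ s.mem 6 t = (toggles ch n 0).2 t) ?_)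
    fun s ⟨h0, h1, h2, m4, hs⟩ => Ends.seq
      (walkLoop_ends hB (fun t => (horb t).2) h0 h1 h2 m4 rfl rfl rfl)
    fun s' ⟨h0, h1, m4, m2, m5, m6⟩ => Ends.seq (Ends.of_wp (Q := fun s => s.reg 0 = n ∧
        s.reg 1 = (chordStep ch)^[n] 1 ∧ s.reg 2 = 0 ∧ s.mem 4 = ch ∧ ∀ t < n, s.mem 2 t = P t ∧
          s.mem 5 t = (toggles ch n 0).1 t ∧ s.mem 6 t = (toggles ch n 0).2 t) ?_)
    fun s ⟨h0, h1, h2, m4, hs⟩ => Ends.seq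
      (toggleLoop_ends hB horb h0 h1 h2 m4 rfl fun x hx => (hs x hx).2)
    fun s' ⟨h0, m2, hs'⟩ => Ends.seq (Ends.of_wp (Q := fun s => s.reg 0 = n ∧ s.reg 1 = 0 ∧
        s.reg 2 = 0 ∧ s.reg 3 = n - 1 ∧ ∀ x < n, s.mem 2 x = P x ∧
          s.mem 5 x = (toggles ch n n).1 x ∧ s.mem 6 x = (toggles ch n n).2 x) ?_)
    fun s ⟨h0, h1, h2, h3, hs⟩ => outputLoop_ends hn hB
      (fun x hx => (hlt x hx).1) (fun x hx => (hlt x hx).2) hP h0 h1 h2 h3 hs).mono ?_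
    fun _ h => h
  · simp [wp, Fits, eval, h0, m4]
    exact ⟨by omega, by omega, hs⟩
  · simp [wp, Fits, eval, h0, h1, m4, m2, m5, m6]
    exact ⟨by omega, hs⟩
  · simp [wp, Fits, eval, h0, m2]
    exact ⟨by omega, by omega, by omega, fun x hx => ⟨(hs x hx).1, hs' x hx⟩⟩
  · simp only [Program.time, Expr.cost]
    omega

/-- The chords are determined only during the run, so the combinatorial input `hch` is demanded for
every pair of arrays that satisfies the invariants of the chord search, and the conclusion returns
such a pair. -/
theorem anotherHamiltonianCycle_ends {B n a b : ℕ} {I c off d : ℕ → ℕ} {nb : ℕ → ℕ → ℕ}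
    (hn : 4 ≤ n) (hB : 2 * n + 5 < B)
    (hI0 : I 0 = n) (ha : a < n) (hb : b < n) (hI1 : I 1 = c a) (hI2 : I 2 = c b)
    (hI : ∀ t < n, I (t + 3) = c t) (hc : ∀ t < n, c t < n)
    (hinj : ∀ t < n, ∀ t' < n, c t = c t' → t = t') {st : ℕ}
    (hst : st = if a < b then (if a + 1 < b then 0 else b) else if b + 1 < a then 0 else a)
    {P : ℕ → ℕ} (hP : ∀ t, P t = c ((st + t) % n)) (hPsurj : ∀ w < n, ∃ t < n, P t = w)
    (hoffB : ∀ w < n, off w + d w + 1 < B) (hoff0 : off 0 = n + 3)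
    (hoff : ∀ w < n, off (w + 1) = off w + 1 + d w) (hd : ∀ w < n, I (off w) = d w)
    (hnb : ∀ w < n, ∀ k < d w, I (off w + 1 + k) = nb w k ∧ nb w k < n)
    (hch : ∀ Q ch : ℕ → ℕ, (∀ t < n, Q (P t) = t) → (∀ w < n, HoldsChord n d nb Q ch w) →
      (∀ t, 0 < (chordStep ch)^[t] 1 ∧ (chordStep ch)^[t] 1 < n ∧
        ch ((chordStep ch)^[t] 1) < n) ∧
      ∀ x < n, (toggles ch n n).1 x < n ∧ (toggles ch n n).2 x < n)
    {s : Store} (m0 : s.mem 0 = I) :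
    Ends B anotherHamiltonianCycle (1000 * (n + 1) + 100 * ∑ w ∈ Finset.range n, d w) s fun s =>
      s.reg 0 = n ∧ ∃ Q ch : ℕ → ℕ, (∀ t < n, Q (P t) = t) ∧
        (∀ w < n, HoldsChord n d nb Q ch w) ∧
        ∀ t < n, s.mem 1 t
          = P (IsTwoFactor.trav (toggles ch n n).1 (toggles ch n n).2 n t).2 := by
  have hstn : st < n := by rw [hst]; split_ifs <;> omega
  have hPlt : ∀ t, P t < n := fun t => by rw [hP]; exact hc _ (Nat.mod_lt _ (by omega))
  have hB' : n + 5 < B := by omega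
  refine (Ends.seq (Ends.of_wp (Q := fun s => s.reg 0 = n ∧ s.reg 2 = 0 ∧ s.mem 0 = I) ?_)
    fun s ⟨h0, h2, m0⟩ => Ends.seq (indexLoop_ends hB' hI hc hinj h0 h2 m0)
    fun s ⟨h0, m0, m3⟩ => Ends.seq (findStart_ends hB' ha hb hI1 hI2 hc h0 m0 m3)
    fun s ⟨h0, m0, h2, h1⟩ => Ends.seq
      (rotateLoop_ends hB' hI hstn hc hinj h0 (h1.trans hst.symm) h2 m0)
    fun s ⟨h0, m0, hs⟩ => Ends.seq (closeLinks_ends (P := P) (by omega) hB' h0 m0 ?_)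
    fun s ⟨h0, m0, h1, h2, hs⟩ => Ends.seq (R := fun s => s.reg 0 = n ∧ ∃ Q ch : ℕ → ℕ,
        s.mem 4 = ch ∧ (∀ t < n, Q (P t) = t) ∧ (∀ w < n, HoldsChord n d nb Q ch w) ∧
        ∀ t < n, s.mem 2 t = P t ∧ s.mem 5 t = (toggles ch n 0).1 t ∧
          s.mem 6 t = (toggles ch n 0).2 t)
        (T₁ := 300 * (n + 1) + 100 * ∑ w ∈ Finset.range n, d w) ?_
    fun s ⟨h0, Q, ch, m4, hQ, hC, hs⟩ => (exchange_ends (by omega) hB' (fun x _ => hPlt x)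
      (hch Q ch hQ hC).1 (hch Q ch hQ hC).2 h0 m4 hs).mono le_rfl
      fun s ⟨h0, ho⟩ => ⟨h0, Q, ch, hQ, hC, ho⟩).mono ?_ fun _ h => h
  · simp [wp, Fits, eval, m0, hI0]
    omega
  · intro t ht
    rw [hP]
    exact hs t ht
  · have hQ : ∀ t < n, s.mem 3 (P t) = t := fun t ht => (hs t ht).2.1
    refine (chordLoop_ends hB hoffB hoff0 hoff hd hnb ?_ ?_ h0 h1 h2 m0 rfl rfl rfl rfl).mono
      le_rfl ?_
    · intro w hw
      obtain ⟨t, ht, rfl⟩ := hPsurj w hw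
      rw [hQ t ht]
      exact ht
    · intro w hw w' hw' he
      obtain ⟨t, ht, rfl⟩ := hPsurj w hw
      obtain ⟨t', ht', rfl⟩ := hPsurj w' hw'
      rw [hQ t ht, hQ t' ht'] at he
      rw [he]
    · rintro s' ⟨h0, m2, m5, m6, hC⟩
      refine ⟨h0, _, _, rfl, hQ, hC, fun t ht => ?_⟩
      rw [m2, m5, m6]
      exact ⟨(hs t ht).1, (hs t ht).2.2⟩
  · simp only [Program.time, Expr.cost]
    omega

end WordRAM

/-! ### Hamiltonian cycles as lists, and the encoding of the input. -/

namespace List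

theorem getD_flatMap_take {α β : Type*} (f : α → List β) (z : β) (l : List α) :
    ∀ (w : ℕ) (hw : w < l.length) (k : ℕ), k < (f l[w]).length →
      (l.flatMap f).getD (((l.take w).flatMap f).length + k) z = (f l[w]).getD k z := by
  induction l with
  | nil => intro w hw; simp at hw
  | cons x l ih =>
    rintro (_ | w) hw k hk
    · simp only [getElem_cons_zero] at hk
      simp only [take_zero, flatMap_nil, length_nil, zero_add, flatMap_cons, getElem_cons_zero]
      rw [getD_append _ _ _ _ hk]
    · simp only [getElem_cons_succ] at hk
      simp only [take_succ_cons, flatMap_cons, length_append, getElem_cons_succ]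
      rw [getD_append_right _ _ _ _ (by omega), ← ih w (by simpa using hw) k hk]
      congr 1
      omega

end List

namespace SimpleGraph

theorem Walk.support_tail_eq_map_range {V : Type*} {G : SimpleGraph V} {a b : V} (W : G.Walk a b) :
    W.support.tail = (List.range W.length).map fun t => W.getVert (t + 1) := by
  refine List.ext_getElem (by simp) fun i h1 h2 => ?_
  simp only [List.length_map, List.length_range] at h2
  simp [W.getVert_eq_support_getElem (show i + 1 ≤ W.length by omega)]

variable {n : ℕ} {G : SimpleGraph (Fin n)}

theorem Walk.cyclicOrder_eq {a : Fin n} (C : G.Walk a a) :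
    C.cyclicOrder = (List.range C.length).map fun t => (C.getVert (t + 1) : ℕ) := by
  rw [Walk.cyclicOrder, Walk.support_tail_eq_map_range]
  simp [List.map_eq_flatMap, List.flatMap_assoc]

theorem add_one_mod_eq_ite {x n : ℕ} (h : x < n) :
    (x + 1) % n = if x + 1 < n then x + 1 else 0 := by
  split_ifs with h'
  · exact Nat.mod_eq_of_lt h'
  · rw [show x + 1 = n by omega, Nat.mod_self]

namespace Walk.IsHamiltonianCycle

variable {a : Fin n} {H : G.Walk a a}

theorem length_eq_n (hH : H.IsHamiltonianCycle) : H.length = n := by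
  simpa using hH.length_eq

theorem getVert_succ_inj (hH : H.IsHamiltonianCycle) {t t' : ℕ} (ht : t < n) (ht' : t' < n)
    (h : H.getVert (t + 1) = H.getVert (t' + 1)) : t = t' := by
  have hl := hH.length_eq_n
  have := hH.isCycle.getVert_injOn (by simp only [Set.mem_ofPred_eq]; omega)
    (by simp only [Set.mem_ofPred_eq]; omega) h
  omega

theorem getVert_n (hH : H.IsHamiltonianCycle) : H.getVert n = a := by
  have := H.getVert_length
  rwa [hH.length_eq_n] at this

theorem exists_getVert_succ (hH : H.IsHamiltonianCycle) (w : Fin n) :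
    ∃ t < n, H.getVert (t + 1) = w := by
  have hl := hH.length_eq_n
  obtain ⟨t, ht, htl⟩ := Walk.mem_support_iff_exists_getVert.1 (hH.mem_support w)
  rcases Nat.eq_zero_or_pos t with rfl | h0
  · refine ⟨n - 1, by have := w.pos; omega, ?_⟩
    rw [Walk.getVert_zero] at ht
    rw [Nat.sub_add_cancel w.pos, hH.getVert_n, ht]
  · exact ⟨t - 1, by omega, by rw [Nat.sub_add_cancel h0, ht]⟩

theorem getVert_mod (H : G.Walk a a) {x : ℕ} (hx : x < n) :
    H.getVert ((x + 1) % n + 1) = if x + 1 = n then H.getVert 1 else H.getVert (x + 2) := by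
  rw [add_one_mod_eq_ite hx]
  split_ifs <;> first | omega | rfl

theorem adj_getVert_mod (hH : H.IsHamiltonianCycle) {x : ℕ} (hx : x < n) :
    G.Adj (H.getVert (x + 1)) (H.getVert ((x + 1) % n + 1)) := by
  have hl := hH.length_eq_n
  rw [getVert_mod H hx]
  split_ifs with h
  · have := H.adj_getVert_succ (i := 0) (by omega)
    rw [Walk.getVert_zero] at this
    rwa [h, hH.getVert_n]
  · exact H.adj_getVert_succ (by omega)

theorem exists_of_mem_edges (hH : H.IsHamiltonianCycle) {e : Sym2 (Fin n)} (he : e ∈ H.edges) :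
    ∃ x < n, e = s(H.getVert (x + 1), H.getVert ((x + 1) % n + 1)) := by
  have hl := hH.length_eq_n
  obtain ⟨i, hi, rfl⟩ := List.getElem_of_mem he
  rw [Walk.getElem_edges]
  rw [Walk.length_edges, hl] at hi
  rcases Nat.eq_zero_or_pos i with rfl | h0
  · refine ⟨n - 1, by omega, ?_⟩
    rw [getVert_mod H (by omega), if_pos (by omega), Nat.sub_add_cancel (by omega),
      Walk.getVert_zero, hH.getVert_n]
  · refine ⟨i - 1, by omega, ?_⟩
    rw [getVert_mod H (by omega), if_neg (by omega), Nat.sub_add_cancel h0,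
      show i - 1 + 2 = i + 1 by omega]

/-- A Hamiltonian cycle of a bipartite graph, started at the step `st`. -/
theorem exists_isHamOrder (hH : H.IsHamiltonianCycle) (hG : G.IsBipartite) (hn : 4 ≤ n) (st : ℕ) :
    ∃ q, G.IsHamOrder n (fun t => H.getVert ((st + t) % n + 1)) q := by
  have hmod : ∀ t, (st + t) % n < n := fun t => Nat.mod_lt _ (by omega)
  have hinj : ∀ t < n, ∀ t' < n,
      H.getVert ((st + t) % n + 1) = H.getVert ((st + t') % n + 1) → t = t' := by
    intro t ht t' ht' he
    have h1 := hH.getVert_succ_inj (hmod t) (hmod t') he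
    have h2 : t ≡ t' [MOD n] := Nat.ModEq.add_left_cancel' st h1
    exact h2.eq_of_lt_of_lt ht ht'
  have hsurj : ∀ w, ∃ t < n, H.getVert ((st + t) % n + 1) = w := by
    intro w
    obtain ⟨x, hx, rfl⟩ := hH.exists_getVert_succ w
    -- This is the residue of `x - st`, with `n` added to keep the subtraction from truncating.
    refine ⟨(x + (n - st % n)) % n, Nat.mod_lt _ (by omega), ?_⟩
    have : (st + (x + (n - st % n)) % n) % n = x := by
      have h1 := Nat.mod_lt st (show 0 < n by omega)
      rw [Nat.add_mod_mod, ← Nat.mod_add_mod,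
        show st % n + (x + (n - st % n)) = x + n by omega, Nat.add_mod_right,
        Nat.mod_eq_of_lt hx]
    rw [this]
  choose q hq hpq using hsurj
  have hqp : ∀ t < n, q (H.getVert ((st + t) % n + 1)) = t := fun t ht =>
    hinj _ (hq _) _ ht (hpq _)
  have hadj : ∀ t, G.Adj (H.getVert ((st + t) % n + 1)) (H.getVert ((st + (t + 1)) % n + 1)) := by
    intro t
    have := hH.adj_getVert_mod (hmod t)
    rwa [Nat.mod_add_mod, Nat.add_assoc] at this
  obtain ⟨col⟩ := hG
  -- With two colours, the colour alternates along the cycle, so it records the parity of the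
  -- position.
  have hcol : ∀ t, (col (H.getVert ((st + t) % n + 1)) = col (H.getVert ((st + 0) % n + 1)) ↔
      t % 2 = 0) := by
    intro t
    induction t with
    | zero => simp
    | succ t ih =>
      have h1 := col.valid (hadj t)
      have key : ∀ x y z : Fin 2, x ≠ y → (y = z ↔ ¬ x = z) := by decide
      rw [key _ _ _ h1, ih]
      omega
  refine ⟨q, hn, hqp, hq, hpq, fun t _ => hadj t, ?_, ?_⟩
  · have := hadj (n - 1)
    rwa [Nat.sub_add_cancel (by omega), Nat.add_mod_right, ← Nat.add_zero st] at this
  · intro x y hxy hpar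
    have h1 := hcol (q x)
    have h2 := hcol (q y)
    rw [hpq] at h1 h2
    have h3 := col.valid hxy
    have key : ∀ x y z : Fin 2, x ≠ y → ¬ (x = z ↔ y = z) := by decide
    exact key _ _ _ h3 (h1.trans ((by rw [hpar]) : _ ↔ _) |>.trans h2.symm)

end Walk.IsHamiltonianCycle

namespace IsHamOrder

variable {p : ℕ → Fin n} {q : Fin n → ℕ}

/-- At most two of the three neighbours are cyclically adjacent to `j`. Since `j` is odd, its
predecessor is `j - 1`, and only the successor may wrap around. -/
theorem exists_apart (h : G.IsHamOrder n p q) [DecidableRel G.Adj] (hdeg : ∀ v, 3 ≤ G.degree v)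
    {j : ℕ} (hj : j < n) (hodd : j % 2 = 1) :
    ∃ x, G.Adj (p j) x ∧ WordRAM.Apart n j (q x) := by
  obtain ⟨x, hx, hx'⟩ : ∃ x ∈ G.neighborFinset (p j),
      x ∉ ({p (j - 1), p ((j + 1) % n)} : Finset _) :=
    Finset.exists_mem_notMem_of_card_lt_card
      (lt_of_le_of_lt Finset.card_le_two (by rw [card_neighborFinset_eq_degree]; exact hdeg _))
  rw [mem_neighborFinset] at hx
  refine ⟨x, hx, ?_⟩
  have h1 := h.parity _ _ hx
  have h2 := h.q_lt x
  rw [h.q_p j hj] at h1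
  have h3 : q x ≠ j - 1 := fun he => hx' (by rw [← he, h.p_q]; simp)
  have h4 : q x ≠ (j + 1) % n := fun he => hx' (by rw [← he, h.p_q]; simp)
  rw [add_one_mod_eq_ite hj] at h4
  unfold WordRAM.Apart
  split_ifs at h4 <;> omega

end IsHamOrder

section Encoding

/-- The number of neighbours of the vertex `w`. -/
def listDegree (adj : Fin n → List (Fin n)) (w : ℕ) : ℕ :=
  if h : w < n then (adj ⟨w, h⟩).length else 0

/-- The neighbour number `k` of the vertex `w`. -/
def listNeighbor (adj : Fin n → List (Fin n)) (w k : ℕ) : ℕ :=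
  if h : w < n then ((adj ⟨w, h⟩).map Fin.val).getD k 0 else 0

/-- The part of the input for the vertex `w`. -/
def vertexBlock (adj : Fin n → List (Fin n)) (w : Fin n) : List ℕ :=
  (adj w).length :: (adj w).map Fin.val

/-- The address of the part of the input for the vertex `w`. -/
def blockOffset (adj : Fin n → List (Fin n)) (w : ℕ) : ℕ :=
  n + 3 + (((List.finRange n).take w).flatMap (vertexBlock adj)).length

variable (adj : Fin n → List (Fin n))

theorem blockOffset_zero : blockOffset adj 0 = n + 3 := by simp [blockOffset]

theorem blockOffset_succ {w : ℕ} (hw : w < n) :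
    blockOffset adj (w + 1) = blockOffset adj w + 1 + listDegree adj w := by
  rw [blockOffset, blockOffset, List.take_succ_eq_append_getElem (by simpa using hw)]
  simp [vertexBlock, listDegree, hw]
  omega

/-- The closed form bounds all addresses of the input by the sum of the degrees. -/
theorem blockOffset_eq {w : ℕ} (hw : w ≤ n) :
    blockOffset adj w = n + 3 + w + ∑ i ∈ Finset.range w, listDegree adj i := by
  induction w with
  | zero => simp [blockOffset]
  | succ w ih =>
    rw [blockOffset_succ adj (by omega), ih (by omega), Finset.sum_range_succ]
    omega

variable {a : Fin n} (H : G.Walk a a) (u v : Fin n)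

theorem encodeInput_eq : encodeInput adj H u v
    = [n, (u : ℕ), (v : ℕ)] ++ H.cyclicOrder ++ (List.finRange n).flatMap (vertexBlock adj) := by
  rw [encodeInput]
  congr 2
  funext w
  simp [vertexBlock, List.map_eq_flatMap]

theorem encodeInput_getD_cycle (hH : H.length = n) {t : ℕ} (ht : t < n) :
    (encodeInput adj H u v).getD (t + 3) 0 = H.getVert (t + 1) := by
  rw [encodeInput_eq, List.append_assoc, List.getD_append_right _ _ _ _ (by simp),
    Walk.cyclicOrder_eq, List.getD_append _ _ _ _ (by simp; omega)]
  simp [hH, ht]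

theorem encodeInput_getD_block (hH : H.length = n) {w k : ℕ} (hw : w < n)
    (hk : k < (vertexBlock adj ⟨w, hw⟩).length) :
    (encodeInput adj H u v).getD (blockOffset adj w + k) 0
      = (vertexBlock adj ⟨w, hw⟩).getD k 0 := by
  have hlen : ([n, (u : ℕ), (v : ℕ)] ++ H.cyclicOrder).length = n + 3 := by
    simp [Walk.cyclicOrder_eq, hH]
  have := List.getD_flatMap_take (vertexBlock adj) 0 (List.finRange n) w (by simpa using hw) k
    (by simpa using hk)
  simp only [List.getElem_finRange, Fin.cast_mk] at this
  rw [← this, encodeInput_eq, List.getD_append_right _ _ _ _ (by rw [hlen, blockOffset]; omega), hlen,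
    blockOffset]
  congr 1
  omega

theorem encodeInput_getD_degree (hH : H.length = n) {w : ℕ} (hw : w < n) :
    (encodeInput adj H u v).getD (blockOffset adj w) 0 = listDegree adj w := by
  have := encodeInput_getD_block adj H u v hH hw (k := 0) (by simp [vertexBlock])
  rw [Nat.add_zero] at this
  rw [this, listDegree, dif_pos hw]
  rfl

theorem encodeInput_getD_neighbor (hH : H.length = n) {w k : ℕ} (hw : w < n)
    (hk : k < listDegree adj w) :
    (encodeInput adj H u v).getD (blockOffset adj w + 1 + k) 0 = listNeighbor adj w k := by
  rw [listDegree, dif_pos hw] at hk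
  have := encodeInput_getD_block adj H u v hH hw (k := k + 1) (by simp [vertexBlock, hk])
  rw [Nat.add_assoc, Nat.add_comm 1 k, this, listNeighbor, dif_pos hw]
  rfl

variable {adj} {u v}

theorem IsAdjacencyLists.listDegree_eq [DecidableRel G.Adj] (hadj : G.IsAdjacencyLists adj)
    (w : Fin n) : listDegree adj w = G.degree w := by
  rw [listDegree, dif_pos w.isLt, ← card_neighborFinset_eq_degree,
    ← List.toFinset_card_of_nodup (hadj w).1]
  congr 1
  ext x
  rw [List.mem_toFinset, mem_neighborFinset, (hadj w).2]

theorem IsAdjacencyLists.sum_listDegree [DecidableRel G.Adj] (hadj : G.IsAdjacencyLists adj) :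
    ∑ w ∈ Finset.range n, listDegree adj w = 2 * G.edgeFinset.card := by
  rw [← G.sum_degrees_eq_twice_card_edges, Finset.sum_range]
  exact Finset.sum_congr rfl fun w _ => hadj.listDegree_eq w

theorem IsAdjacencyLists.exists_listNeighbor (hadj : G.IsAdjacencyLists adj) {w x : Fin n} :
    G.Adj w x ↔ ∃ k < listDegree adj w, listNeighbor adj w k = x := by
  rw [← (hadj w).2, List.mem_iff_getElem]
  simp only [listDegree, listNeighbor, w.isLt, dif_pos, Fin.eta]
  constructor
  · rintro ⟨k, hk, rfl⟩
    exact ⟨k, hk, by simp [hk]⟩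
  · rintro ⟨k, hk, h⟩
    refine ⟨k, hk, Fin.ext ?_⟩
    simpa [hk] using h

theorem listNeighbor_lt {w k : ℕ} (hw : w < n) (hk : k < listDegree adj w) :
    listNeighbor adj w k < n := by
  rw [listDegree, dif_pos hw] at hk
  rw [listNeighbor, dif_pos hw]
  simp [hk]

end Encoding

end SimpleGraph

/-! ### Correctness and running time of the program. -/

namespace SimpleGraph

variable {n : ℕ} {G : SimpleGraph (Fin n)} {p : ℕ → Fin n} {q : Fin n → ℕ}

/-- A chord is not an edge between consecutive positions. -/
theorem IsHamOrder.chord_ne (h : G.IsHamOrder n p q) {j i t : ℕ} (hj : j < n)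
    (hodd : j % 2 = 1) (hc : G.IsChord n p j i) (ht : t < n) :
    s(p j, p i) ≠ s(p t, p ((t + 1) % n)) := by
  intro he
  have hm := Nat.mod_lt (t + 1) (show 0 < n by omega)
  obtain ⟨h1, -, h2⟩ := hc
  have h4 := h.four_le
  have key : ∀ x < n, ∀ y < n, p x = p y → x = y := fun x hx y hy hxy => by
    rw [← h.q_p x hx, hxy, h.q_p y hy]
  rw [Sym2.eq_iff] at he
  have e := add_one_mod_eq_ite ht
  rcases he with ⟨h5, h6⟩ | ⟨h5, h6⟩
  · have h5 := key _ hj _ ht h5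
    have h6 := key _ h1 _ hm h6
    rw [e] at h6
    split_ifs at h6 <;> omega
  · have h5 := key _ hj _ hm h5
    have h6 := key _ h1 _ ht h6
    rw [e] at h5
    split_ifs at h5 <;> omega

/-- The chords that the program finds. -/
theorem IsHamOrder.isChord_of_holdsChord (h : G.IsHamOrder n p q) [DecidableRel G.Adj]
    (hdeg : ∀ v, 3 ≤ G.degree v) {adj : Fin n → List (Fin n)} (hadj : G.IsAdjacencyLists adj)
    {Q ch : ℕ → ℕ} (hQ : ∀ t < n, Q (p t) = t)
    (hC : ∀ w < n, WordRAM.HoldsChord n (listDegree adj) (listNeighbor adj) Q ch w)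
    {j : ℕ} (hj : j < n) (hodd : j % 2 = 1) : G.IsChord n p j (ch j) := by
  have hQ' : ∀ x : Fin n, Q x = q x := fun x => by
    have := hQ (q x) (h.q_lt x)
    rwa [h.p_q] at this
  obtain ⟨x, hx, hxa⟩ := h.exists_apart hdeg hj hodd
  obtain ⟨k, hk, hkx⟩ := hadj.exists_listNeighbor.1 hx
  obtain ⟨k', hk', h1, h2⟩ := hC (p j) (p j).isLt ⟨k, hk, by
    rw [hQ j hj, hkx, hQ']; exact hxa⟩
  have hlt := listNeighbor_lt (p j).isLt hk'
  rw [hQ j hj] at h1 h2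
  have h3 : ch j = q ⟨_, hlt⟩ := by rw [h1, ← hQ']
  refine ⟨by rw [h3]; exact h.q_lt _, ?_, h2⟩
  rw [h3, h.p_q]
  exact hadj.exists_listNeighbor.2 ⟨k', hk', rfl⟩

/-- The two ends of an edge of a Hamiltonian cycle are at consecutive steps. -/
theorem Walk.IsHamiltonianCycle.exists_steps {a : Fin n} {H : G.Walk a a}
    (hH : H.IsHamiltonianCycle) (hn : 4 ≤ n) {u v : Fin n} (huv : s(u, v) ∈ H.edges) :
    ∃ i < n, ∃ j < n, u = H.getVert (i + 1) ∧ v = H.getVert (j + 1) ∧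
      ∃ st < n, st = (if i < j then (if i + 1 < j then 0 else j) else if j + 1 < i then 0 else i) ∧
        s(H.getVert ((st + (n - 1)) % n + 1), H.getVert (st % n + 1)) = s(u, v) := by
  obtain ⟨x, hx, he⟩ := hH.exists_of_mem_edges huv
  have hm := add_one_mod_eq_ite hx
  have hlt := Nat.mod_lt (x + 1) (show 0 < n by omega)
  have hpred : ((x + 1) % n + (n - 1)) % n = x := by
    rw [Nat.mod_add_mod, show x + 1 + (n - 1) = x + n by omega, Nat.add_mod_right,
      Nat.mod_eq_of_lt hx]
  have hst : s(H.getVert (((x + 1) % n + (n - 1)) % n + 1), H.getVert ((x + 1) % n % n + 1))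
      = s(u, v) := by rw [hpred, Nat.mod_mod, he]
  rcases Sym2.eq_iff.1 he with ⟨h1, h2⟩ | ⟨h1, h2⟩
  · refine ⟨x, hx, _, hlt, h1, h2, _, hlt, ?_, hst⟩
    generalize (x + 1) % n = y at *
    split_ifs at hm ⊢ <;> omega
  · refine ⟨_, hlt, x, hx, h1, h2, _, hlt, ?_, hst⟩
    generalize (x + 1) % n = y at *
    split_ifs at hm ⊢ <;> omega

end SimpleGraph

open SimpleGraph WordRAM in
/-- The program finds another Hamiltonian cycle through the given edge in linear time. -/
theorem anotherHamiltonianCycle_outputs (n : ℕ) (G : SimpleGraph (Fin n)) [DecidableRel G.Adj]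
    (hbip : G.IsBipartite) (hpf : G.IsPfaffian) (hdeg : ∀ v, 3 ≤ G.degree v)
    (adj : Fin n → List (Fin n)) (hadj : G.IsAdjacencyLists adj) (a : Fin n) (H : G.Walk a a)
    (hH : H.IsHamiltonianCycle) (u v : Fin n) (huv : s(u, v) ∈ H.edges) :
    ∃ (b : Fin n) (H' : G.Walk b b),
      H'.IsHamiltonianCycle ∧ H'.edgeSet ≠ H.edgeSet ∧ s(u, v) ∈ H'.edges ∧
      anotherHamiltonianCycle.Outputs ((n + G.edgeFinset.card) ^ 2)
        (2000 * (n + G.edgeFinset.card)) (encodeInput adj H u v) H'.cyclicOrder := by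
  have hn : 4 ≤ n := by
    have := (hdeg a).trans_lt (G.degree_lt_card_verts a)
    rw [Fintype.card_fin] at this
    omega
  have hl := hH.length_eq_n
  have hsum := hadj.sum_listDegree
  obtain ⟨i, hi, j, hj, hu, hv, st, hst, hst', hst''⟩ := hH.exists_steps hn huv
  obtain ⟨q, hq⟩ := hH.exists_isHamOrder hbip hn st
  set p : ℕ → Fin n := fun t => H.getVert ((st + t) % n + 1) with hp
  have hm : 6 ≤ G.edgeFinset.card := by
    have h1 : n * 3 ≤ ∑ w ∈ Finset.range n, listDegree adj w := by
      have := Finset.card_nsmul_le_sum (Finset.range n) (listDegree adj) 3 fun w hw => by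
        have := hadj.listDegree_eq ⟨w, Finset.mem_range.1 hw⟩
        simp only at this
        rw [this]
        exact hdeg _
      simpa using this
    omega
  -- All addresses of the input are below the left side, as the degrees sum to twice the number of
  -- edges; `n + m` is at least ten, so its square is large enough.
  have hB : 2 * n + 2 * G.edgeFinset.card + 5 < (n + G.edgeFinset.card) ^ 2 := by
    nlinarith [Nat.zero_le n]
  have hoffB : ∀ w < n, blockOffset adj w + listDegree adj w + 1
      < (n + G.edgeFinset.card) ^ 2 := by
    intro w hw
    have h1 := blockOffset_succ adj hw
    have h2 := blockOffset_eq adj (w := w + 1) hw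
    have h3 : ∑ i ∈ Finset.range (w + 1), listDegree adj i
        ≤ ∑ i ∈ Finset.range n, listDegree adj i :=
      Finset.sum_le_sum_of_subset (Finset.range_mono (by omega))
    omega
  have hchord : ∀ Q ch : ℕ → ℕ, (∀ t < n, Q (p t) = t) →
      (∀ w < n, HoldsChord n (listDegree adj) (listNeighbor adj) Q ch w) →
      ∀ j < n, j % 2 = 1 → G.IsChord n p j (ch j) :=
    fun Q ch hQ hC j hj hodd => hq.isChord_of_holdsChord hdeg hadj hQ hC hj hodd
  obtain ⟨t, s', ht, hrun, h0, Q, ch, hQ, hC, hout⟩ := anotherHamiltonianCycle_ends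
    (B := (n + G.edgeFinset.card) ^ 2) (I := fun j => (encodeInput adj H u v).getD j 0)
    (c := fun t => (H.getVert (t + 1) : ℕ)) (off := blockOffset adj) (d := listDegree adj)
    (nb := listNeighbor adj) (P := fun t => (p t : ℕ)) (s := initStore (encodeInput adj H u v))
    hn (by omega) (by simp [encodeInput]) hi hj (by simp [encodeInput, hu])
    (by simp [encodeInput, hv]) (fun t ht => encodeInput_getD_cycle adj H u v hl ht)
    (fun t _ => (H.getVert (t + 1)).isLt)
    (fun t ht t' ht' he => hH.getVert_succ_inj ht ht' (Fin.ext he)) hst' (fun t => rfl)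
    (fun w hw => ⟨q ⟨w, hw⟩, hq.q_lt _, by rw [hq.p_q]⟩) hoffB (blockOffset_zero adj)
    (fun w hw => blockOffset_succ adj hw)
    (fun w hw => encodeInput_getD_degree adj H u v hl hw)
    (fun w hw k hk => ⟨encodeInput_getD_neighbor adj H u v hl hw hk, listNeighbor_lt hw hk⟩)
    (fun Q ch hQ hC => by
      have hc := hchord Q ch hQ hC
      refine ⟨fun t => ?_, fun x hx => ?_⟩
      · obtain ⟨h1, h2⟩ := hq.iterate_chordStep_odd hc t
        exact ⟨by omega, h1, (hc _ h1 h2).1⟩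
      · exact ⟨(hq.isTwoFactor_toggles hc).1.L_lt x hx, (hq.isTwoFactor_toggles hc).1.R_lt x hx⟩)
    rfl
  have hc := hchord Q ch hQ hC
  obtain ⟨hS, k, hk, hkodd, hkch⟩ := hq.isTwoFactor_toggles hc
  obtain ⟨C, hC1, hC2, hC3⟩ := hS.exists_isHamiltonianCycle hq hpf
  have hkC : s(p k, p (ch k)) ∈ C.edges := by
    rcases hkch with h1 | h1
    · rw [← h1]; exact (hC3 k hk).1
    · rw [← h1]; exact (hC3 k hk).2
  refine ⟨_, C, hC1, fun he => ?_, ?_, t, s', ?_, hrun, ?_⟩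
  -- If the edge sets agreed, the exchanged chord would join two consecutive positions of `H`.
  · have h1 : s(p k, p (ch k)) ∈ H.edgeSet := by rw [← he]; exact hkC
    obtain ⟨x, hx, h2⟩ := hH.exists_of_mem_edges h1
    have h3 : H.getVert (x + 1) = p (q (H.getVert (x + 1))) := (hq.p_q _).symm
    have hlt := hq.q_lt (H.getVert (x + 1))
    generalize q (H.getVert (x + 1)) = y at *
    have h4 := hH.getVert_succ_inj hx (Nat.mod_lt _ (by omega)) h3
    refine hq.chord_ne hk hkodd (hc k hk hkodd) hlt (h2.trans ?_)
    rw [h3, h4]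
    simp only [hp]
    rw [Nat.mod_add_mod, Nat.add_mod_mod, Nat.add_assoc]
  -- The left link of `0` is still `n - 1`, and the start of the rotation makes this link the given
  -- edge.
  · have := (hC3 0 (by omega)).1
    rw [hS.L_zero, Sym2.eq_swap] at this
    rwa [← hst'']
  -- The program takes at most `1000 * (n + 1) + 200 * m` steps, where `m` is the number of edges.
  · omega
  · rw [Store.output, h0, Walk.cyclicOrder_eq, hC1.length_eq_n]
    refine List.map_congr_left fun t ht => ?_
    rw [List.mem_range] at ht
    rw [hout t ht, hC2 t (by rw [hC1.length_eq_n]; exact ht)]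

/-- There is a word RAM program `P` that, given a bipartite Pfaffian graph `G` with minimum degree
at least three (`n` vertices and `m` edges, adjacency lists in any order), a Hamiltonian cycle `H`
in `G` and an edge `{u, v}` of `H`, outputs a Hamiltonian cycle `H' ≠ H` in `G` that contains
`{u, v}`, after at most `c * (n + m)` steps on words of `O(log (n + m))` bits, that is, words that
hold the numbers less than `(n + m) ^ k`. -/
theorem theorem1 :
    ∃ (P : WordRAM.Program) (c k : ℕ),
      ∀ (n : ℕ) (G : SimpleGraph (Fin n)) [DecidableRel G.Adj],
        G.IsBipartite → G.IsPfaffian → (∀ v, 3 ≤ G.degree v) →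
        ∀ (adj : Fin n → List (Fin n)), G.IsAdjacencyLists adj →
        ∀ (a : Fin n) (H : G.Walk a a), H.IsHamiltonianCycle →
        ∀ (u v : Fin n), s(u, v) ∈ H.edges →
          ∃ (b : Fin n) (H' : G.Walk b b),
            H'.IsHamiltonianCycle ∧ H'.edgeSet ≠ H.edgeSet ∧ s(u, v) ∈ H'.edges ∧
            P.Outputs ((n + G.edgeFinset.card) ^ k) (c * (n + G.edgeFinset.card))
              (SimpleGraph.encodeInput adj H u v) H'.cyclicOrder :=
  ⟨WordRAM.anotherHamiltonianCycle, 2000, 2, fun n G _ => anotherHamiltonianCycle_outputs n G⟩
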